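/- Let $\Gamma$ be a finite bipartite distance-regular graph with vertex set $X$, path-length distance $\partial$, diameter $D\ge 4$, valency $k\ge 3$ and intersection numbers $p^h_{ij}=|\{z:\partial(x,z)=i,\ \partial(z,y)=j\}|$ (for any $x,y$ with $\partial(x,y)=h$). Put $c_i=p^i_{1,i-1}$ $(1\le i\le D)$, $b_i=p^i_{1,i+1}$ $(0\le i\le D-1)$, $k_i=p^0_{ii}$ $(0\le i\le D)$, and $c_0=b_D=0$. Let $A_i\in \mathrm{Mat}_X(\mathbb C)$ $(0\le i\le D)$ be the $i$th distance matrix, with $(y,z)$-entry $1$ if $\partial(y,z)=i$ and $0$ otherwise, let $A=A_1$, and let $\theta_0>\theta_1>\cdots>\theta_D$ be the distinct eigenvalues of $A$. Let $f_0,f_1,\dots,f_D\in\mathbb R[\lambda]$ be the polynomials with $f_0=1$, $f_{-1}=0$ and $\lambda f_i=b_{i-1}f_{i-1}+c_{i+1}f_{i+1}$ $(0\le i\le D-1)$, and let $p_i=f_i+f_{i-2}+f_{i-4}+\cdots$ (ending in $f_0$ or $f_1$) for $0\le i\le D$. Fix $x\in X$. For $0\le i\le D$ let $E_i^*$ be the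 diagonal matrix in $\mathrm{Mat}_X(\mathbb C)$ with $(y,y)$-entry $1$ if $\partial(x,y)=i$ and $0$ otherwise, and let $T$ be the subalgebra of $\mathrm{Mat}_X(\mathbb C)$ generated by $A,E_0^*,\dots,E_D^*$. A $T$-module is a $T$-invariant subspace $W$ of $\mathbb C^X$ (equipped with the standard Hermitian inner product); it is irreducible if it is nonzero and contains no $T$-modules other than $0$ and $W$. An irreducible $T$-module $W$ is thin if $\dim E_i^*W\le 1$ for $0\le i\le D$, and its endpoint is $\min\{i: E_i^*W\neq 0\}$. If $W$ is thin irreducible with endpoint $2$, its local eigenvalue is the scalar by which $E_2^*A_2E_2^*$ acts on the one-dimensional space $E_2^*W$. Let $d=\lfloor D/2\rfloor$; choose $n\in\{1,d\}$ if $D$ is odd, and let $n=1$ if $D$ is even. Let $W$ be a thin irreducible $T$-module with endpoint $2$ and local eigenvalue $$\tilde\theta_n=-1-\frac{b_2b_3}{\theta_n^2-b_2},$$ and let $v$ be a nonzero vector in $E_2^*W$. Then the vectors $E_{i+2}^*A_iv$ $(0\le i\le D-4)$ form a basis of $W$, they are mutually orthogonal, and $$\|E_{i+2}^*A_iv\|^2=\frac{k_ib_ib_{i+1}c_{i+1}c_{i+2}}{k\,b_1(\theta_n^2-b_2)}\,\frac{p_{i+2}(\theta_n)}{p_i(\theta_n)}\,\|v\|^2\qquad(0\le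 i\le D-4),$$ where all denominators, including $\theta_n^2-b_2$, are nonzero. -/

import Mathlib

open scoped Polynomial

namespace DRG

noncomputable section

variable {X : Type*} [Fintype X] [DecidableEq X]

/-- The number of vertices `z` at distance `i` from `x` and at distance `j` from `y`. -/
def pairCount (G : SimpleGraph X) (i j : ℕ) (x y : X) : ℕ :=
  (Finset.univ.filter fun z : X => G.dist x z = i ∧ G.dist z y = j).card

/-- A finite connected graph is distance-regular if `pairCount G i j x y` depends, apart from
`i` and `j`, only on the distance of `x` and `y`. -/
def IsDistanceRegular (G : SimpleGraph X) : Prop :=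
  G.Connected ∧ ∀ (i j : ℕ) (x y x' y' : X), G.dist x y = G.dist x' y' →
    pairCount G i j x y = pairCount G i j x' y'

open Classical in
/-- The intersection number `p^h_{ij}`: the value of `pairCount G i j` at any pair of vertices at
distance `h` (and `0` if there is no such pair). -/
def interNum (G : SimpleGraph X) (h i j : ℕ) : ℕ :=
  if H : ∃ q : X × X, G.dist q.1 q.2 = h then pairCount G i j H.choose.1 H.choose.2 else 0

/-- `c_i = p^i_{1,i-1}`, with `c_0 = 0`. -/
def c (G : SimpleGraph X) (i : ℕ) : ℕ := if i = 0 then 0 else interNum G i 1 (i - 1)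

/-- `b_i = p^i_{1,i+1}`; it is `0` for `i` equal to the diameter. -/
def b (G : SimpleGraph X) (i : ℕ) : ℕ := interNum G i 1 (i + 1)

/-- The `i`-th valency `k_i = p^0_{ii}`. -/
def kval (G : SimpleGraph X) (i : ℕ) : ℕ := interNum G 0 i i

/-- The polynomials `f_i`: `f_0 = 1` and `λ f_i = b_{i-1} f_{i-1} + c_{i+1} f_{i+1}`,
with `f_{-1} = 0`. -/
def fPoly (G : SimpleGraph X) : ℕ → ℝ[X]
  | 0 => 1
  | 1 => Polynomial.C ((c G 1 : ℝ)⁻¹) * Polynomial.X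
  | i + 2 => Polynomial.C ((c G (i + 2) : ℝ)⁻¹) *
      (Polynomial.X * fPoly G (i + 1) - Polynomial.C (b G i : ℝ) * fPoly G i)

/-- The polynomials `p_i = f_i + f_{i-2} + f_{i-4} + ⋯`, ending in `f_0` or `f_1`. -/
def pPoly (G : SimpleGraph X) (i : ℕ) : ℝ[X] :=
  ∑ h ∈ (Finset.range (i + 1)).filter (fun h => Even (i - h)), fPoly G h

/-- The finite set of distinct eigenvalues of the adjacency matrix. -/
def eigenvalueSet (G : SimpleGraph X) [DecidableRel G.Adj] : Finset ℝ :=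
  (Module.End.finite_hasEigenvalue (Matrix.toLin' (G.adjMatrix ℝ))).toFinset

/-- `theta G i` is `θ_i`, where `θ_0 > θ_1 > ⋯` are the distinct eigenvalues of the adjacency
matrix in decreasing order (and `0` beyond the last one). -/
def theta (G : SimpleGraph X) [DecidableRel G.Adj] (i : ℕ) : ℝ :=
  ((eigenvalueSet G).sort (· ≥ ·)).getD i 0

/-- `z̃ = -1 - b_2 b_3 / (z² - b_2)`, for `z² ≠ b_2`. -/
def tilde (G : SimpleGraph X) (z : ℝ) : ℝ :=
  -1 - (b G 2 : ℝ) * (b G 3 : ℝ) / (z ^ 2 - (b G 2 : ℝ))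

/-- The `i`-th distance matrix `A_i`. -/
def distMatrix (G : SimpleGraph X) (i : ℕ) : Matrix X X ℂ :=
  Matrix.of fun y z => if G.dist y z = i then 1 else 0

/-- The `i`-th dual idempotent `E*_i` with respect to the vertex `x`. -/
def Estar (G : SimpleGraph X) (x : X) (i : ℕ) : Matrix X X ℂ :=
  Matrix.diagonal fun y => if G.dist x y = i then 1 else 0

/-- The subconstituent (Terwilliger) algebra `T(x)`, generated by the adjacency matrix and the
dual idempotents (`E*_i = 0` for `i` larger than the diameter). -/
def terwilligerAlgebra (G : SimpleGraph X) [DecidableRel G.Adj] (x : X) :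
    Subalgebra ℂ (Matrix X X ℂ) :=
  Algebra.adjoin ℂ ({G.adjMatrix ℂ} ∪ Set.range (Estar G x))

/-- A subspace of the standard module `ℂ^X` that is closed under the action of `T(x)`. -/
def IsTModule (G : SimpleGraph X) [DecidableRel G.Adj] (x : X)
    (W : Submodule ℂ (EuclideanSpace ℂ X)) : Prop :=
  ∀ B ∈ terwilligerAlgebra G x, ∀ w ∈ W, Matrix.toEuclideanLin B w ∈ W

/-- An irreducible `T(x)`-module. -/
def IsIrreducibleTModule (G : SimpleGraph X) [DecidableRel G.Adj] (x : X)
    (W : Submodule ℂ (EuclideanSpace ℂ X)) : Prop :=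
  IsTModule G x W ∧ W ≠ ⊥ ∧
    ∀ W' : Submodule ℂ (EuclideanSpace ℂ X), IsTModule G x W' → W' ≤ W → W' = ⊥ ∨ W' = W

/-- The subspace `E*_i W`. -/
def subconst (G : SimpleGraph X) (x : X) (i : ℕ) (W : Submodule ℂ (EuclideanSpace ℂ X)) :
    Submodule ℂ (EuclideanSpace ℂ X) :=
  W.map (Matrix.toEuclideanLin (Estar G x i))

/-- `W` is thin: each `E*_i W` has dimension at most `1`. -/
def IsThin (G : SimpleGraph X) (x : X) (W : Submodule ℂ (EuclideanSpace ℂ X)) : Prop :=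
  ∀ i, Module.finrank ℂ (subconst G x i W) ≤ 1

/-- The endpoint of `W`: the least `i` with `E*_i W ≠ 0`. -/
def endpoint (G : SimpleGraph X) (x : X) (W : Submodule ℂ (EuclideanSpace ℂ X)) : ℕ :=
  sInf {i | subconst G x i W ≠ ⊥}

/-- `E*_2 A_2 E*_2` acts on `E*_2 W` as the scalar `η`. For a thin irreducible module `W` of
endpoint `2`, where `E*_2 W` is one-dimensional, this says that `η` is the local eigenvalue
of `W`. -/
def HasLocalEigenvalue (G : SimpleGraph X) (x : X) (W : Submodule ℂ (EuclideanSpace ℂ X))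
    (η : ℝ) : Prop :=
  ∀ w ∈ subconst G x 2 W,
    Matrix.toEuclideanLin (Estar G x 2 * distMatrix G 2 * Estar G x 2) w = (η : ℂ) • w

/-- The vector `E*_{i+2} A_i v`. -/
def basisVec (G : SimpleGraph X) (x : X) (v : EuclideanSpace ℂ X) (i : ℕ) : EuclideanSpace ℂ X :=
  Matrix.toEuclideanLin (Estar G x (i + 2) * distMatrix G i) v

end

end DRG

/-!
Write `u_j = E*_{j+2} A_j v`. Since `W` has endpoint `2`, its vector `v` is supported at distance
`2` from `x`, has coordinate sum `0` and is killed by `E*_1 A`. Comparing layers in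
`A A_j = b_{j-1} A_{j-1} + c_{j+1} A_{j+1}`, and using that in a bipartite graph the parity of
`∂(y, z)` is determined by `∂(x, y)` and `∂(x, z)`, one gets `E*_{j+3} A u_j = c_{j+1} u_{j+1}` and
expresses `E*_{j+2} A u_{j+1}` through `u_j` and `E*_{j+2} A_{j+4} v`. By thinness the latter is a
multiple of `u_j`; the local eigenvalue gives the multiple for `j = 0`, and the three-term
recurrence of the `p_i` at `θ_n` carries it from `j` to `j + 1`, provided that no `p_i(θ_n)` with
`i ≤ D - 2` vanishes. As `A` is symmetric, this determines all the norms; since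
`p_{D-1}(θ_n) = 0` it also gives `u_{D-3} = 0`, so `u_0, …, u_{D-4}` span a `T`-submodule, which
is all of `W`.

The `p_i` satisfy a three-term recurrence with positive coefficients, and the zeros of `p_{D-1}`
are exactly `θ_1, …, θ_{D-1}`. Hence `p_0, …, p_{D-1}` is a Sturm chain and no earlier member
vanishes at the largest zero `θ_1`. For odd `D`, the even members with alternating signs form a
Sturm chain as well, read from `0` outwards, and `θ_{(D-1)/2}` is the smallest positive zero of
`p_{D-1}`.
-/

namespace DRG

section Sturm

variable {f : ℝ → ℝ} {s t T : ℝ}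

lemma nonneg_of_forall_Ioc_pos (hf : Continuous f) (htT : t < T)
    (hpos : ∀ x ∈ Set.Ioc t T, 0 < f x) : 0 ≤ f t := by
  have hsub : closure (Set.Ioc t T) ⊆ f ⁻¹' Set.Ici 0 :=
    closure_minimal (fun x hx => (hpos x hx).le) (isClosed_Ici.preimage hf)
  rw [closure_Ioc htT.ne] at hsub
  exact hsub (Set.left_mem_Icc.2 htT.le)

lemma exists_last_zero (hf : Continuous f) (hT : 0 < f T) (hs : s ∈ Set.Icc t T)
    (hfs : f s ≤ 0) : ∃ z ∈ Set.Ico t T, f z = 0 ∧ ∀ x ∈ Set.Ioc z T, 0 < f x := by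
  have hcompact : IsCompact (Set.Icc t T ∩ f ⁻¹' Set.Iic 0) :=
    isCompact_Icc.inter_right (isClosed_Iic.preimage hf)
  obtain ⟨z, ⟨hz, hfz⟩, hmax⟩ := hcompact.exists_isGreatest ⟨s, hs, hfs⟩
  have hpos : ∀ x ∈ Set.Ioc z T, 0 < f x := fun x hx => by
    by_contra! hle
    exact hx.1.not_ge (hmax ⟨⟨hz.1.trans hx.1.le, hx.2⟩, hle⟩)
  have hzT : z < T := hz.2.lt_of_ne fun h => hT.not_ge (h ▸ hfz)
  exact ⟨z, ⟨hz.1, hzT⟩, le_antisymm hfz (nonneg_of_forall_Ioc_pos hf hzT hpos), hpos⟩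

lemma forall_Ioc_pos_of_ne_zero (hf : Continuous f) (hT : 0 < f T)
    (hne : ∀ x ∈ Set.Ioc t T, f x ≠ 0) : ∀ x ∈ Set.Ioc t T, 0 < f x := fun x hx => by
  by_contra! hle
  obtain ⟨z, hz, hfz, -⟩ := exists_last_zero hf hT ⟨le_rfl, hx.2⟩ hle
  exact hne z ⟨hx.1.trans_le hz.1, hz.2.le⟩ hfz

variable {g : ℕ → ℝ → ℝ} {N : ℕ}

lemma sturm_forall_Icc_pos (hg : ∀ j, Continuous (g j)) (h0 : ∀ x, 0 < g 0 x)
    (hT : ∀ j ≤ N, 0 < g j T)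
    (hsign : ∀ j, j + 2 ≤ N → ∀ x, g (j + 1) x = 0 → 0 < g j x → g (j + 2) x < 0)
    {j : ℕ} (hj : j + 1 ≤ N) (htT : t < T) (hpos : ∀ x ∈ Set.Ioc t T, 0 < g (j + 1) x) :
    ∀ x ∈ Set.Icc t T, 0 < g j x := by
  induction j generalizing t with
  | zero => exact fun x _ => h0 x
  | succ j ih =>
    intro x hx
    by_contra! hle
    obtain ⟨z, hz, hgz, hzpos⟩ := exists_last_zero (hg _) (hT _ (by omega)) hx hle
    have hpred : 0 < g j z := ih (by omega) hz.2 hzpos z (Set.left_mem_Icc.2 hz.2.le)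
    exact (hsign j hj z hgz hpred).not_ge <|
      nonneg_of_forall_Ioc_pos (hg _) hz.2 fun y hy => hpos y ⟨hz.1.trans_lt hy.1, hy.2⟩

lemma sturm_pos_of_lt (hg : ∀ j, Continuous (g j)) (h0 : ∀ x, 0 < g 0 x)
    (hT : ∀ j ≤ N, 0 < g j T)
    (hsign : ∀ j, j + 2 ≤ N → ∀ x, g (j + 1) x = 0 → 0 < g j x → g (j + 2) x < 0)
    {i j : ℕ} (hij : i < j) (hj : j ≤ N) (htT : t < T) (hne : ∀ x ∈ Set.Ioc t T, g j x ≠ 0) :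
    0 < g i t := by
  have hpos := forall_Ioc_pos_of_ne_zero (hg j) (hT j hj) hne
  clear hne
  induction j with
  | zero => omega
  | succ j ih =>
    have hpred := sturm_forall_Icc_pos hg h0 hT hsign hj htT hpos
    rcases Nat.lt_succ_iff_lt_or_eq.1 hij with hij | rfl
    · exact ih hij (by omega) fun x hx => hpred x (Set.Ioc_subset_Icc_self hx)
    · exact hpred t (Set.left_mem_Icc.2 htT.le)

end Sturm

/-- A finite sequence `p_0, …, p_N` of real polynomials with `p_0 = 1`, `p_1 = X` and a three-term
recurrence with positive coefficients and no diagonal term, as satisfied by the orthogonal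
polynomials of a symmetric weight. -/
structure IsSymmetricThreeTerm (p : ℕ → ℝ[X]) (N : ℕ) : Prop where
  zero : p 0 = 1
  one : p 1 = Polynomial.X
  recurrence : ∀ i, i + 2 ≤ N → ∃ β γ : ℝ, 0 < β ∧ 0 < γ ∧
    Polynomial.X * p (i + 1) = Polynomial.C γ * p (i + 2) + Polynomial.C β * p i

namespace IsSymmetricThreeTerm

variable {p : ℕ → ℝ[X]} {N : ℕ}

lemma exists_mul_eval_eq (hp : IsSymmetricThreeTerm p N) {i : ℕ} (hi : i + 2 ≤ N) :
    ∃ β γ : ℝ, 0 < β ∧ 0 < γ ∧ ∀ t : ℝ,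
      t * (p (i + 1)).eval t = γ * (p (i + 2)).eval t + β * (p i).eval t := by
  obtain ⟨β, γ, hβ, hγ, hrec⟩ := hp.recurrence i hi
  refine ⟨β, γ, hβ, hγ, fun t => ?_⟩
  simpa using congrArg (Polynomial.eval t) hrec

lemma natDegree_le (hp : IsSymmetricThreeTerm p N) {i : ℕ} (hi : i ≤ N) :
    (p i).natDegree ≤ i := by
  induction i using Nat.twoStepInduction with
  | zero => simp [hp.zero]
  | one => simp [hp.one]
  | more i ih0 ih1 =>
    obtain ⟨β, γ, -, hγ, hrec⟩ := hp.recurrence i hi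
    have hsolve : p (i + 2) = Polynomial.C γ⁻¹ *
        (Polynomial.X * p (i + 1) - Polynomial.C β * p i) := by
      rw [hrec, add_sub_cancel_right, ← mul_assoc, ← Polynomial.C_mul, inv_mul_cancel₀ hγ.ne',
        Polynomial.C_1, one_mul]
    rw [hsolve]
    refine (Polynomial.natDegree_C_mul_le _ _).trans
      ((Polynomial.natDegree_sub_le _ _).trans (max_le ?_ ?_))
    · exact Polynomial.natDegree_mul_le.trans (by
        have := ih1 (by omega)
        rw [Polynomial.natDegree_X]
        omega)
    · exact (Polynomial.natDegree_C_mul_le _ _).trans ((ih0 (by omega)).trans (by omega))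

lemma eval_neg_of_eval_eq_zero (hp : IsSymmetricThreeTerm p N) {i : ℕ} (hi : i + 2 ≤ N) {t : ℝ}
    (hzero : (p (i + 1)).eval t = 0) (hpos : 0 < (p i).eval t) : (p (i + 2)).eval t < 0 := by
  obtain ⟨β, γ, hβ, hγ, hrec⟩ := hp.exists_mul_eval_eq hi
  have h := hrec t
  rw [hzero, mul_zero] at h
  exact neg_of_mul_neg_right (by linarith [mul_pos hβ hpos]) hγ.le

lemma eval_pos_of_forall_ne_zero (hp : IsSymmetricThreeTerm p N) {t T : ℝ}
    (hT : ∀ j ≤ N, 0 < (p j).eval T) {i j : ℕ} (hij : i < j) (hj : j ≤ N) (htT : t < T)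
    (hne : ∀ x ∈ Set.Ioc t T, (p j).eval x ≠ 0) : 0 < (p i).eval t :=
  sturm_pos_of_lt (g := fun j x => (p j).eval x) (fun j => (p j).continuous)
    (fun x => by simp [hp.zero]) hT (fun _ hj _ => hp.eval_neg_of_eval_eq_zero hj) hij hj htT hne

lemma eval_zero_pos (hp : IsSymmetricThreeTerm p N) {j : ℕ} (hj : 2 * j ≤ N) :
    0 < (-1) ^ j * (p (2 * j)).eval 0 := by
  induction j with
  | zero => simp [hp.zero]
  | succ j ih =>
    obtain ⟨β, γ, hβ, hγ, hrec⟩ := hp.exists_mul_eval_eq (i := 2 * j) hj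
    have h := hrec 0
    rw [zero_mul] at h
    refine pos_of_mul_pos_right (a := γ) ?_ hγ.le
    calc (0 : ℝ) < β * ((-1) ^ j * (p (2 * j)).eval 0) := mul_pos hβ (ih (by omega))
      _ = γ * ((-1) ^ (j + 1) * (p (2 * (j + 1))).eval 0) := by
          rw [show 2 * (j + 1) = 2 * j + 2 by ring, pow_succ]
          linear_combination -(-1) ^ j * h

lemma even_eval_neg_of_eval_eq_zero (hp : IsSymmetricThreeTerm p N) {j : ℕ}
    (hj : 2 * (j + 2) ≤ N) {t : ℝ} (hzero : (p (2 * (j + 1))).eval t = 0)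
    (hpos : 0 < (-1) ^ j * (p (2 * j)).eval t) :
    (-1) ^ (j + 2) * (p (2 * (j + 2))).eval t < 0 := by
  obtain ⟨β₀, γ₀, hβ₀, hγ₀, hrec₀⟩ := hp.exists_mul_eval_eq (i := 2 * j) (by omega)
  obtain ⟨β₁, γ₁, hβ₁, hγ₁, hrec₁⟩ := hp.exists_mul_eval_eq (i := 2 * j + 1) (by omega)
  obtain ⟨β₂, γ₂, hβ₂, hγ₂, hrec₂⟩ := hp.exists_mul_eval_eq (i := 2 * j + 2) (by omega)
  have h₀ := hrec₀ t
  have h₁ := hrec₁ t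
  have h₂ := hrec₂ t
  rw [show 2 * (j + 1) = 2 * j + 2 by ring] at hzero
  simp only [add_assoc, Nat.reduceAdd] at h₁ h₂
  rw [hzero] at h₀ h₁ h₂
  have hchain : γ₁ * γ₂ * ((-1) ^ (j + 2) * (p (2 * (j + 2))).eval t) =
      -(β₀ * β₁ * ((-1) ^ j * (p (2 * j)).eval t)) := by
    rw [show 2 * (j + 2) = 2 * j + 4 by ring, pow_add]
    linear_combination (-1) ^ j * (-β₁ * h₀ - t * h₁ - γ₁ * h₂)
  exact neg_of_mul_neg_right (hchain.trans_lt (neg_neg_of_pos (by positivity)))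
    (by positivity)

lemma even_eval_pos_of_forall_ne_zero (hp : IsSymmetricThreeTerm p N) {m : ℕ} (hm : 2 * m ≤ N)
    {t : ℝ} (ht : 0 < t) (hne : ∀ x ∈ Set.Ico 0 t, (p (2 * m)).eval x ≠ 0) {i : ℕ} (hi : i < m) :
    0 < (-1) ^ i * (p (2 * i)).eval t := by
  have h := sturm_pos_of_lt (g := fun j x => (-1) ^ j * (p (2 * j)).eval (-x)) (N := m) (T := 0)
    (t := -t) (by fun_prop) (fun x => by simp [hp.zero])
    (fun j hj => by simpa using hp.eval_zero_pos (by omega))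
    (fun j hj x hzero hpos => hp.even_eval_neg_of_eval_eq_zero (by omega)
      ((mul_eq_zero_iff_left (pow_ne_zero _ (by norm_num))).1 hzero) hpos) hi le_rfl (by linarith)
    (fun x hx => mul_ne_zero (pow_ne_zero _ (by norm_num))
      (hne _ ⟨by linarith [hx.2], by linarith [hx.1]⟩))
  simpa using h

lemma odd_eval_pos_of_even_eval_pos (hp : IsSymmetricThreeTerm p N) {t : ℝ} (ht : 0 < t) {m : ℕ}
    (heven : ∀ i < m, 0 < (-1) ^ i * (p (2 * i)).eval t) {i : ℕ} (hi : i < m)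
    (hiN : 2 * i + 1 ≤ N) :
    0 < (-1) ^ i * (p (2 * i + 1)).eval t := by
  induction i with
  | zero => simpa [hp.one] using ht
  | succ i ih =>
    obtain ⟨β, γ, hβ, hγ, hrec⟩ := hp.exists_mul_eval_eq (i := 2 * i + 1) (by omega)
    refine pos_of_mul_pos_right (a := γ) ?_ hγ.le
    calc 0 < t * ((-1) ^ (i + 1) * (p (2 * (i + 1))).eval t) +
            β * ((-1) ^ i * (p (2 * i + 1)).eval t) :=
          add_pos (mul_pos ht (heven _ hi)) (mul_pos hβ (ih (by omega) (by omega)))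
      _ = γ * ((-1) ^ (i + 1) * (p (2 * (i + 1) + 1)).eval t) := by
          have h := hrec t
          simp only [add_assoc, Nat.reduceAdd] at h
          rw [show 2 * (i + 1) + 1 = 2 * i + 3 by ring, show 2 * (i + 1) = 2 * i + 2 by ring,
            pow_succ]
          linear_combination -(-1) ^ i * h

lemma eval_ne_zero_of_forall_even_ne_zero (hp : IsSymmetricThreeTerm p N) {m : ℕ}
    (hm : 2 * m ≤ N) {t : ℝ} (ht : 0 < t) (hne : ∀ x ∈ Set.Ico 0 t, (p (2 * m)).eval x ≠ 0)
    {i : ℕ} (hi : i < 2 * m) : (p i).eval t ≠ 0 := by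
  have heven := fun j (hj : j < m) => hp.even_eval_pos_of_forall_ne_zero hm ht hne hj
  obtain ⟨j, rfl | rfl⟩ := Nat.even_or_odd' i
  · exact right_ne_zero_of_mul (heven j (by omega)).ne'
  · exact right_ne_zero_of_mul
      (hp.odd_eval_pos_of_even_eval_pos ht heven (by omega) (by omega)).ne'

end IsSymmetricThreeTerm

section Distance

variable {X : Type*} {G : SimpleGraph X}

lemma exists_adj_dist_eq (hG : G.Connected) {y z : X} {i : ℕ} (hyz : G.dist y z = i + 1) :
    ∃ w, G.Adj y w ∧ G.dist w z = i := by
  obtain ⟨p, hp⟩ := hG.exists_walk_length_eq_dist y z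
  cases p with
  | nil => simp at hyz
  | @cons _ w _ hyw q =>
    have hq := G.dist_le q
    have htriangle := hG.dist_triangle (u := y) (v := w) (w := z)
    rw [SimpleGraph.dist_eq_one_iff_adj.2 hyw] at htriangle
    rw [SimpleGraph.Walk.length_cons] at hp
    exact ⟨w, hyw, by omega⟩

lemma dist_le_diam_of_connected [Finite X] (hG : G.Connected) (y z : X) :
    G.dist y z ≤ G.diam := by
  have := hG.nonempty
  exact SimpleGraph.dist_le_diam (SimpleGraph.connected_iff_ediam_ne_top.1 hG)

lemma exists_dist_eq [Finite X] (hG : G.Connected) {i : ℕ} (hi : i ≤ G.diam) :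
    ∃ y z, G.dist y z = i := by
  have := hG.nonempty
  induction hi using Nat.decreasingInduction with
  | self => exact G.exists_dist_eq_diam
  | of_succ i _ ih =>
    obtain ⟨y, z, hyz⟩ := ih
    obtain ⟨w, -, hw⟩ := exists_adj_dist_eq hG hyz
    exact ⟨w, z, hw⟩

lemma exists_bool_even_dist_iff (hG : G.Connected) (hbip : G.IsBipartite) :
    ∃ color : G.Coloring Bool, ∀ y z, Even (G.dist y z) ↔ (color y ↔ color z) := by
  obtain ⟨color⟩ := hbip
  refine ⟨SimpleGraph.recolorOfEquiv G finTwoEquiv color, fun y z => ?_⟩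
  obtain ⟨p, hp⟩ := hG.exists_walk_length_eq_dist y z
  rw [← hp]
  exact SimpleGraph.Coloring.even_length_iff_congr _ p

lemma even_dist_add (hG : G.Connected) (hbip : G.IsBipartite) (x y z : X) :
    Even (G.dist x y + G.dist y z + G.dist x z) := by
  obtain ⟨color, hcolor⟩ := exists_bool_even_dist_iff hG hbip
  rw [Nat.even_add, Nat.even_add, hcolor, hcolor, hcolor]
  tauto

lemma dist_eq_succ_or_succ_eq (hG : G.Connected) (hbip : G.IsBipartite) {y w : X}
    (hyw : G.Adj y w) (z : X) :
    G.dist w z = G.dist y z + 1 ∨ G.dist w z + 1 = G.dist y z := by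
  have heven := even_dist_add hG hbip y w z
  have hdiff := hyw.diff_dist_adj (u := z)
  simp only [G.dist_comm (u := z)] at hdiff
  rw [SimpleGraph.dist_eq_one_iff_adj.2 hyw] at heven
  obtain ⟨r, hr⟩ := heven
  omega

end Distance

section IntersectionNumbers

variable {X : Type*} [Fintype X] {G : SimpleGraph X}

lemma pairCount_one [DecidableRel G.Adj] (j : ℕ) (y z : X) :
    pairCount G 1 j y z = ((G.neighborFinset y).filter fun w => G.dist w z = j).card := by
  simp only [pairCount, SimpleGraph.dist_eq_one_iff_adj]
  congr 1
  ext w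
  simp

lemma c_zero : c G 0 = 0 := if_pos rfl

namespace IsDistanceRegular

lemma connected (h : IsDistanceRegular G) : G.Connected := h.1

lemma interNum_dist (h : IsDistanceRegular G) (i j : ℕ) (y z : X) :
    interNum G (G.dist y z) i j = pairCount G i j y z := by
  have hexists : ∃ q : X × X, G.dist q.1 q.2 = G.dist y z := ⟨(y, z), rfl⟩
  rw [interNum, dif_pos hexists]
  exact h.2 _ _ _ _ _ _ hexists.choose_spec

lemma card_dist_eq (h : IsDistanceRegular G) (i : ℕ) (y : X) :
    (Finset.univ.filter fun z => G.dist y z = i).card = kval G i := by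
  rw [kval, ← G.dist_self (v := y), h.interNum_dist, pairCount]
  simp only [G.dist_comm (v := y), and_self]

lemma kval_zero (h : IsDistanceRegular G) : kval G 0 = 1 := by
  classical
  obtain ⟨y⟩ := h.connected.nonempty
  rw [← h.card_dist_eq 0 y, Finset.card_eq_one]
  exact ⟨y, by ext z; simp [h.connected.dist_eq_zero_iff, eq_comm]⟩

lemma card_neighbor_dist_eq_succ [DecidableRel G.Adj] (h : IsDistanceRegular G) (y z : X) :
    ((G.neighborFinset y).filter fun w => G.dist w z = G.dist y z + 1).card =
      b G (G.dist y z) := by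
  rw [b, h.interNum_dist, pairCount_one]

lemma card_neighbor_succ_eq_dist [DecidableRel G.Adj] (h : IsDistanceRegular G) (y z : X) :
    ((G.neighborFinset y).filter fun w => G.dist w z + 1 = G.dist y z).card =
      c G (G.dist y z) := by
  rcases Nat.eq_zero_or_pos (G.dist y z) with h0 | h0
  · simp [h0, c_zero]
  · rw [c, if_neg h0.ne', h.interNum_dist, pairCount_one]
    exact congrArg Finset.card (Finset.filter_congr fun w _ => by omega)

lemma degree_eq [DecidableRel G.Adj] (h : IsDistanceRegular G) (y : X) : G.degree y = b G 0 := by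
  have hcard := h.card_neighbor_dist_eq_succ y y
  rw [G.dist_self] at hcard
  rw [← hcard, ← G.card_neighborFinset_eq_degree, Finset.filter_true_of_mem]
  intro w hw
  rw [zero_add, G.dist_comm, SimpleGraph.dist_eq_one_iff_adj]
  exact (G.mem_neighborFinset _ _).1 hw

lemma b_diam (h : IsDistanceRegular G) : b G G.diam = 0 := by
  classical
  obtain ⟨y, z, hyz⟩ := exists_dist_eq h.connected le_rfl
  rw [← hyz, ← h.card_neighbor_dist_eq_succ y z, Finset.card_eq_zero,
    Finset.filter_eq_empty_iff]
  intro w _ hw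
  have := dist_le_diam_of_connected h.connected w z
  omega

lemma b_pos (h : IsDistanceRegular G) {i : ℕ} (hi : i < G.diam) : 0 < b G i := by
  classical
  obtain ⟨z, y, hzy⟩ := exists_dist_eq h.connected (i := i + 1) hi
  obtain ⟨w, hzw, hw⟩ := exists_adj_dist_eq h.connected hzy
  rw [← hw, ← h.card_neighbor_dist_eq_succ w y, Finset.card_pos]
  exact ⟨z, by simp [hzw.symm, hw, hzy]⟩

lemma c_succ_pos (h : IsDistanceRegular G) {i : ℕ} (hi : i < G.diam) : 0 < c G (i + 1) := by
  classical
  obtain ⟨y, z, hyz⟩ := exists_dist_eq h.connected (i := i + 1) hi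
  obtain ⟨w, hyw, hw⟩ := exists_adj_dist_eq h.connected hyz
  rw [← hyz, ← h.card_neighbor_succ_eq_dist y z, Finset.card_pos]
  exact ⟨w, by simp [hyw, hw, hyz]⟩

lemma c_one (h : IsDistanceRegular G) (hdiam : 0 < G.diam) : c G 1 = 1 := by
  classical
  obtain ⟨y, z, hyz⟩ := exists_dist_eq h.connected (i := 1) hdiam
  rw [← hyz, ← h.card_neighbor_succ_eq_dist y z, hyz, Finset.card_eq_one]
  refine ⟨z, Finset.ext fun w => ?_⟩
  simp only [Finset.mem_filter, SimpleGraph.mem_neighborFinset, Finset.mem_singleton,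
    Nat.add_eq_right, h.connected.dist_eq_zero_iff]
  exact ⟨And.right, fun hwz => ⟨hwz ▸ SimpleGraph.dist_eq_one_iff_adj.1 hyz, hwz⟩⟩

lemma kval_mul_b (h : IsDistanceRegular G) (i : ℕ) :
    kval G i * b G i = kval G (i + 1) * c G (i + 1) := by
  classical
  obtain ⟨y⟩ := h.connected.nonempty
  rw [← h.card_dist_eq i y, ← h.card_dist_eq (i + 1) y]
  refine Finset.card_mul_eq_card_mul G.Adj (fun z hz => ?_) (fun z hz => ?_)
  · have hzy : G.dist z y = i := by simpa [G.dist_comm] using hz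
    rw [← hzy, ← h.card_neighbor_dist_eq_succ z y]
    congr 1
    ext w
    simp [Finset.bipartiteAbove, hzy, G.dist_comm (u := y), and_comm]
  · have hzy : G.dist z y = i + 1 := by simpa [G.dist_comm] using hz
    rw [← hzy, ← h.card_neighbor_succ_eq_dist z y]
    congr 1
    ext w
    simp [Finset.bipartiteBelow, hzy, G.dist_comm (u := y), G.adj_comm w, and_comm]

end IsDistanceRegular

/-- Bipartite distance-regular graphs; the diameter is `G.diam` and the valency is `b G 0`. -/
structure IsBipartiteDRG (G : SimpleGraph X) : Prop where
  distanceRegular : IsDistanceRegular G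
  bipartite : G.IsBipartite

namespace IsBipartiteDRG

lemma connected (h : IsBipartiteDRG G) : G.Connected := h.distanceRegular.connected

lemma b_add_c (h : IsBipartiteDRG G) {i : ℕ} (hi : i ≤ G.diam) :
    b G i + c G i = b G 0 := by
  classical
  obtain ⟨y, z, rfl⟩ := exists_dist_eq h.connected hi
  rw [← h.distanceRegular.card_neighbor_dist_eq_succ y z,
    ← h.distanceRegular.card_neighbor_succ_eq_dist y z, ← Finset.card_union_of_disjoint,
    ← Finset.filter_or, Finset.filter_true_of_mem, G.card_neighborFinset_eq_degree,
    h.distanceRegular.degree_eq]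
  · exact fun w hw =>
      dist_eq_succ_or_succ_eq h.connected h.bipartite ((G.mem_neighborFinset _ _).1 hw) z
  · rw [Finset.disjoint_filter]
    omega

lemma c_diam (h : IsBipartiteDRG G) : c G G.diam = b G 0 := by
  simpa [h.distanceRegular.b_diam] using h.b_add_c le_rfl

lemma card_neighbor_dist_eq [DecidableRel G.Adj] (h : IsBipartiteDRG G) (j : ℕ) (y z : X) :
    ((G.neighborFinset y).filter fun w => G.dist w z = j + 1).card =
      (if G.dist y z = j then b G j else 0) +
        (if G.dist y z = j + 2 then c G (j + 2) else 0) := by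
  split_ifs with hb hc hc
  · omega
  · rw [← hb, h.distanceRegular.card_neighbor_dist_eq_succ, add_zero]
  · rw [← hc, ← h.distanceRegular.card_neighbor_succ_eq_dist, hc]
    simp
  · rw [add_zero, Finset.card_eq_zero, Finset.filter_eq_empty_iff]
    intro w hw
    have := dist_eq_succ_or_succ_eq h.connected h.bipartite ((G.mem_neighborFinset _ _).1 hw) z
    omega

end IsBipartiteDRG

end IntersectionNumbers

section Polynomials

variable {X : Type*} [Fintype X] {G : SimpleGraph X}

lemma pPoly_zero : pPoly G 0 = 1 := by
  simp [pPoly, fPoly]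

lemma pPoly_one : pPoly G 1 = fPoly G 1 := by
  simp [pPoly, Finset.sum_filter, Finset.sum_range_succ]

lemma pPoly_add_two (i : ℕ) : pPoly G (i + 2) = pPoly G i + fPoly G (i + 2) := by
  simp only [pPoly, Finset.sum_filter]
  rw [Finset.sum_range_succ, Finset.sum_range_succ]
  have hodd : ¬ Even (i + 2 - (i + 1)) := by simp [show i + 2 - (i + 1) = 1 by omega]
  rw [if_neg hodd, add_zero, if_pos (by simp)]
  congr 1
  refine Finset.sum_congr rfl fun h hh => ?_
  have hh' : h ≤ i := Nat.lt_succ_iff.1 (Finset.mem_range.1 hh)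
  simp [show i + 2 - h = i - h + 2 by omega, Nat.even_add]

lemma sum_range_fPoly (i : ℕ) :
    ∑ j ∈ Finset.range (i + 2), fPoly G j = pPoly G i + pPoly G (i + 1) := by
  induction i with
  | zero => simp [Finset.sum_range_succ, pPoly_zero, pPoly_one, fPoly]
  | succ i ih => rw [Finset.sum_range_succ, ih, pPoly_add_two]; ring

namespace IsDistanceRegular

lemma fPoly_one (h : IsDistanceRegular G) (hdiam : 0 < G.diam) :
    fPoly G 1 = Polynomial.X := by
  simp [fPoly, h.c_one hdiam]

lemma X_mul_fPoly (h : IsDistanceRegular G) {i : ℕ} (hi : i + 2 ≤ G.diam) :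
    Polynomial.X * fPoly G (i + 1) =
      (b G i : ℝ[X]) * fPoly G i + (c G (i + 2) : ℝ[X]) * fPoly G (i + 2) := by
  have hc : (c G (i + 2) : ℝ) ≠ 0 := by exact_mod_cast (h.c_succ_pos hi).ne'
  rw [fPoly, ← Polynomial.C_eq_natCast, ← Polynomial.C_eq_natCast, ← mul_assoc,
    ← Polynomial.C_mul, mul_inv_cancel₀ hc, Polynomial.C_1]
  ring

end IsDistanceRegular

namespace IsBipartiteDRG

lemma X_mul_pPoly_eq_valency_mul (h : IsBipartiteDRG G) {i : ℕ} (hi : i + 2 ≤ G.diam) :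
    Polynomial.X * pPoly G (i + 1) =
      (b G 0 : ℝ[X]) * pPoly G i + (c G (i + 2) : ℝ[X]) * fPoly G (i + 2) := by
  have hf := h.distanceRegular.X_mul_fPoly hi
  have hone := h.distanceRegular.fPoly_one (by omega)
  induction i using Nat.twoStepInduction with
  | zero => simpa [pPoly_zero, pPoly_one, fPoly] using hf
  | one =>
    have hbc : (b G 1 : ℝ[X]) + 1 = b G 0 := by
      exact_mod_cast h.distanceRegular.c_one (by omega) ▸ h.b_add_c (i := 1) (by omega)
    rw [pPoly_add_two, pPoly_zero, pPoly_one]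
    rw [hone] at hf ⊢
    linear_combination hf + Polynomial.X * hbc
  | more i ih _ =>
    have hbc : (b G (i + 2) : ℝ[X]) + c G (i + 2) = b G 0 := by
      exact_mod_cast h.b_add_c (i := i + 2) (by omega)
    have ih := ih (by omega) (h.distanceRegular.X_mul_fPoly (by omega))
    rw [pPoly_add_two (i + 1), pPoly_add_two i]
    linear_combination ih + hf + fPoly G (i + 2) * hbc

lemma X_mul_pPoly (h : IsBipartiteDRG G) {i : ℕ} (hi : i + 2 ≤ G.diam) :
    Polynomial.X * pPoly G (i + 1) =
      (c G (i + 2) : ℝ[X]) * pPoly G (i + 2) + (b G (i + 2) : ℝ[X]) * pPoly G i := by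
  have hbc : (b G (i + 2) : ℝ[X]) + c G (i + 2) = b G 0 := by exact_mod_cast h.b_add_c hi
  rw [h.X_mul_pPoly_eq_valency_mul hi, pPoly_add_two]
  linear_combination -pPoly G i * hbc

lemma mul_eval_pPoly (h : IsBipartiteDRG G) {i : ℕ} (hi : i + 2 ≤ G.diam) (t : ℝ) :
    t * (pPoly G (i + 1)).eval t =
      c G (i + 2) * (pPoly G (i + 2)).eval t + b G (i + 2) * (pPoly G i).eval t := by
  simpa using congrArg (Polynomial.eval t) (h.X_mul_pPoly hi)

lemma isSymmetricThreeTerm (h : IsBipartiteDRG G) (hdiam : 0 < G.diam) :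
    IsSymmetricThreeTerm (pPoly G) (G.diam - 1) where
  zero := pPoly_zero
  one := pPoly_one.trans (h.distanceRegular.fPoly_one hdiam)
  recurrence i hi := by
    refine ⟨b G (i + 2), c G (i + 2), ?_, ?_, by simpa using h.X_mul_pPoly (by omega)⟩
    · exact_mod_cast h.distanceRegular.b_pos (by omega)
    · exact_mod_cast h.distanceRegular.c_succ_pos (i := i + 1) (by omega)

lemma c_mul_eval_fPoly_valency (h : IsBipartiteDRG G) {i : ℕ} (hi : i < G.diam) :
    (c G (i + 1) : ℝ) * (fPoly G (i + 1)).eval (b G 0 : ℝ) =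
      b G i * (fPoly G i).eval (b G 0 : ℝ) := by
  induction i with
  | zero => simp [fPoly, h.distanceRegular.c_one hi]
  | succ i ih =>
    have hrec := congrArg (Polynomial.eval (b G 0 : ℝ)) (h.distanceRegular.X_mul_fPoly hi)
    have hbc : (b G (i + 1) : ℝ) + c G (i + 1) = b G 0 := by
      exact_mod_cast h.b_add_c (i := i + 1) (by omega)
    simp only [Polynomial.eval_mul, Polynomial.eval_add, Polynomial.eval_X,
      Polynomial.eval_natCast] at hrec
    linear_combination ih (by omega) - hrec - (fPoly G (i + 1)).eval (b G 0 : ℝ) * hbc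

lemma eval_fPoly_valency_pos (h : IsBipartiteDRG G) {i : ℕ} (hi : i ≤ G.diam) :
    0 < (fPoly G i).eval (b G 0 : ℝ) := by
  induction i with
  | zero => simp [fPoly]
  | succ i ih =>
    have hb : (0 : ℝ) < b G i := by exact_mod_cast h.distanceRegular.b_pos hi
    have hc : (0 : ℝ) < c G (i + 1) := by exact_mod_cast h.distanceRegular.c_succ_pos hi
    refine pos_of_mul_pos_right ?_ hc.le
    rw [h.c_mul_eval_fPoly_valency hi]
    exact mul_pos hb (ih (by omega))

lemma eval_pPoly_valency_pos (h : IsBipartiteDRG G) {i : ℕ} (hi : i ≤ G.diam) :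
    0 < (pPoly G i).eval (b G 0 : ℝ) := by
  induction i using Nat.twoStepInduction with
  | zero => simp [pPoly_zero]
  | one => simpa [pPoly_one] using h.eval_fPoly_valency_pos hi
  | more i ih _ =>
    rw [pPoly_add_two, Polynomial.eval_add]
    exact add_pos (ih (by omega)) (h.eval_fPoly_valency_pos hi)

lemma pPoly_ne_zero (h : IsBipartiteDRG G) {i : ℕ} (hi : i ≤ G.diam) : pPoly G i ≠ 0 := fun h0 =>
  (h.eval_pPoly_valency_pos hi).ne' (by rw [h0, Polynomial.eval_zero])

lemma card_roots_pPoly_toFinset_le (h : IsBipartiteDRG G) (hD : 0 < G.diam) :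
    (pPoly G (G.diam - 1)).roots.toFinset.card ≤ G.diam - 1 :=
  (Multiset.toFinset_card_le _).trans ((Polynomial.card_roots' _).trans
    ((h.isSymmetricThreeTerm hD).natDegree_le le_rfl))

end IsBipartiteDRG

end Polynomials

section DistanceMatrices

variable {X : Type*} {G : SimpleGraph X}

lemma distMatrix_zero [DecidableEq X] (hG : G.Connected) : distMatrix G 0 = 1 := by
  ext y z
  simp [distMatrix, Matrix.one_apply, hG.dist_eq_zero_iff]

lemma distMatrix_one [DecidableRel G.Adj] : distMatrix G 1 = G.adjMatrix ℂ := by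
  ext y z
  simp [distMatrix, SimpleGraph.adjMatrix_apply, SimpleGraph.dist_eq_one_iff_adj]

lemma distMatrix_eq_zero [Finite X] (hG : G.Connected) {j : ℕ} (hj : G.diam < j) :
    distMatrix G j = 0 := by
  ext y z
  have := dist_le_diam_of_connected hG y z
  simp [distMatrix, show G.dist y z ≠ j by omega]

lemma sum_distMatrix [Finite X] (hG : G.Connected) :
    ∑ j ∈ Finset.range (G.diam + 1), distMatrix G j = Matrix.of fun _ _ => 1 := by
  ext y z
  simp [distMatrix, Matrix.sum_apply, dist_le_diam_of_connected hG y z]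

variable [Fintype X] [DecidableRel G.Adj]

namespace IsBipartiteDRG

lemma adjMatrix_mul_distMatrix (h : IsBipartiteDRG G) (j : ℕ) :
    G.adjMatrix ℂ * distMatrix G (j + 1) =
      b G j • distMatrix G j + c G (j + 2) • distMatrix G (j + 2) := by
  ext y z
  rw [SimpleGraph.adjMatrix_mul_apply]
  simp only [distMatrix, Matrix.of_apply, Matrix.add_apply, Matrix.smul_apply, Finset.sum_boole]
  rw [h.card_neighbor_dist_eq]
  split_ifs <;> simp

variable [DecidableEq X]

lemma distMatrix_eq_aeval (h : IsBipartiteDRG G) (hdiam : 0 < G.diam) {j : ℕ}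
    (hj : j ≤ G.diam) :
    distMatrix G j = Polynomial.aeval (G.adjMatrix ℂ) (fPoly G j) := by
  induction j using Nat.twoStepInduction with
  | zero => simp [distMatrix_zero h.connected, fPoly]
  | one => rw [distMatrix_one, h.distanceRegular.fPoly_one hdiam, Polynomial.aeval_X]
  | more j ih0 ih1 =>
    have hrec := congrArg (Polynomial.aeval (G.adjMatrix ℂ)) (h.distanceRegular.X_mul_fPoly hj)
    simp only [map_mul, map_add, ← nsmul_eq_mul, map_nsmul,
      Polynomial.aeval_X] at hrec
    rw [← ih0 (by omega), ← ih1 (by omega), h.adjMatrix_mul_distMatrix, add_right_inj,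
      ← Nat.cast_smul_eq_nsmul ℂ, ← Nat.cast_smul_eq_nsmul ℂ] at hrec
    exact smul_right_injective _ (Nat.cast_ne_zero.2 (h.distanceRegular.c_succ_pos hj).ne') hrec

lemma distMatrix_mem_terwilligerAlgebra (h : IsBipartiteDRG G) (hdiam : 0 < G.diam) (x : X)
    (j : ℕ) : distMatrix G j ∈ terwilligerAlgebra G x := by
  rcases lt_or_ge G.diam j with hj | hj
  · exact distMatrix_eq_zero h.connected hj ▸ zero_mem _
  · rw [h.distMatrix_eq_aeval hdiam hj, ← Polynomial.aeval_map_algebraMap ℂ]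
    exact Algebra.adjoin_mono Set.subset_union_left
      (Polynomial.aeval_mem_adjoin_singleton ℂ (G.adjMatrix ℂ))

end IsBipartiteDRG

end DistanceMatrices

section Eigenvalues

open Matrix

lemma aeval_mulVec_of_mulVec_eq_smul {X R S : Type*} [Fintype X] [DecidableEq X] [CommSemiring R]
    [CommSemiring S] [Algebra R S] {M : Matrix X X S} {θ : R} {w : X → S}
    (hw : M *ᵥ w = θ • w) (p : R[X]) :
    Polynomial.aeval M p *ᵥ w = p.eval θ • w := by
  induction p using Polynomial.induction_on' with
  | add p q hp hq => rw [map_add, add_mulVec, hp, hq, Polynomial.eval_add, add_smul]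
  | monomial n a =>
    have hpow : M ^ n *ᵥ w = θ ^ n • w := by
      induction n with
      | zero => simp
      | succ n ih => rw [pow_succ', ← mulVec_mulVec, ih, mulVec_smul, hw, smul_smul, pow_succ]
    rw [Polynomial.aeval_monomial, ← Algebra.smul_def, smul_mulVec, hpow, smul_smul,
      Polynomial.eval_monomial]

variable {X : Type*} [Fintype X] {G : SimpleGraph X} [DecidableRel G.Adj] {θ : ℝ}

lemma IsDistanceRegular.sum_eq_zero_of_ne_valency (h : IsDistanceRegular G) {w : X → ℂ}
    (hw : G.adjMatrix ℂ *ᵥ w = θ • w) (hne : θ ≠ b G 0) : ∑ z, w z = 0 := by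
  have hones : (1 : X → ℂ) ᵥ* G.adjMatrix ℂ = (b G 0 : ℂ) • 1 := by
    ext y
    simp [SimpleGraph.adjMatrix_vecMul_apply, h.degree_eq]
  have hsum : (b G 0 : ℂ) * ∑ z, w z = θ * ∑ z, w z := by
    have := dotProduct_mulVec 1 (G.adjMatrix ℂ) w
    rw [hones, hw, smul_dotProduct, dotProduct_smul, one_dotProduct] at this
    simpa using this.symm
  by_contra h0
  exact hne (by exact_mod_cast (mul_right_cancel₀ h0 hsum).symm)

variable [DecidableEq X]

lemma mem_eigenvalueSet_iff :
    θ ∈ eigenvalueSet G ↔ ∃ w : X → ℝ, w ≠ 0 ∧ G.adjMatrix ℝ *ᵥ w = θ • w := by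
  rw [eigenvalueSet, Set.Finite.mem_toFinset]
  constructor
  · intro hθ
    obtain ⟨w, hw⟩ := Module.End.HasEigenvalue.exists_hasEigenvector hθ
    exact ⟨w, hw.2, hw.apply_eq_smul⟩
  · rintro ⟨w, hw0, hw⟩
    exact Module.End.hasEigenvalue_of_hasEigenvector
      ⟨Module.End.mem_eigenspace_iff.2 hw, hw0⟩

lemma exists_complex_eigenvector (hθ : θ ∈ eigenvalueSet G) :
    ∃ w : X → ℂ, w ≠ 0 ∧ G.adjMatrix ℂ *ᵥ w = θ • w := by
  obtain ⟨w, hw0, hw⟩ := mem_eigenvalueSet_iff.1 hθ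
  refine ⟨fun z => w z, fun h0 => hw0 (funext fun z => ?_), funext fun y => ?_⟩
  · exact Complex.ofReal_eq_zero.1 (congrFun h0 z)
  · have hy := congrFun hw y
    rw [SimpleGraph.adjMatrix_mulVec_apply] at hy ⊢
    simpa using congrArg Complex.ofReal hy

lemma IsDistanceRegular.abs_le_valency (h : IsDistanceRegular G) (hθ : θ ∈ eigenvalueSet G) :
    |θ| ≤ b G 0 := by
  rw [eigenvalueSet, Set.Finite.mem_toFinset] at hθ
  obtain ⟨y, hy⟩ := eigenvalue_mem_ball hθ
  rw [Finset.sum_erase _ (by simp)] at hy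
  simpa [SimpleGraph.adjMatrix_apply, ← h.degree_eq y, ← G.card_neighborFinset_eq_degree,
    G.neighborFinset_eq_filter, apply_ite] using hy

namespace IsBipartiteDRG

lemma eval_sum_fPoly_eq_zero (h : IsBipartiteDRG G) (hdiam : 0 < G.diam)
    (hθ : θ ∈ eigenvalueSet G) (hne : θ ≠ b G 0) :
    (∑ j ∈ Finset.range (G.diam + 1), fPoly G j).eval θ = 0 := by
  obtain ⟨w, hw0, hw⟩ := exists_complex_eigenvector hθ
  have hJ : (Matrix.of fun _ _ : X => (1 : ℂ)) *ᵥ w = 0 := by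
    ext y
    simpa [mulVec, dotProduct] using h.distanceRegular.sum_eq_zero_of_ne_valency hw hne
  rw [← sum_distMatrix h.connected, Finset.sum_congr rfl fun j hj =>
    h.distMatrix_eq_aeval hdiam (Nat.lt_succ_iff.1 (Finset.mem_range.1 hj)), ← map_sum,
    aeval_mulVec_of_mulVec_eq_smul hw] at hJ
  exact (smul_eq_zero.1 hJ).resolve_right hw0

lemma eval_pPoly_eq_zero_of_mem_eigenvalueSet (h : IsBipartiteDRG G) (hdiam : 2 ≤ G.diam)
    (hθ : θ ∈ eigenvalueSet G) (hne : θ ≠ b G 0) (hne_neg : θ ≠ -b G 0) :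
    (pPoly G (G.diam - 1)).eval θ = 0 := by
  have hsum := h.eval_sum_fPoly_eq_zero (by omega) hθ hne
  have hrec := h.mul_eval_pPoly (i := G.diam - 2) (by omega) θ
  rw [show G.diam + 1 = G.diam - 1 + 2 by omega, sum_range_fPoly, Polynomial.eval_add,
    show G.diam - 1 + 1 = G.diam by omega] at hsum
  rw [show G.diam - 2 + 1 = G.diam - 1 by omega, show G.diam - 2 + 2 = G.diam by omega,
    h.c_diam, h.distanceRegular.b_diam] at hrec
  have hprod : (θ + b G 0) * (pPoly G (G.diam - 1)).eval θ = 0 := by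
    linear_combination hrec + b G 0 * hsum
  exact (mul_eq_zero.1 hprod).resolve_left fun h0 => hne_neg (eq_neg_of_add_eq_zero_left h0)

end IsBipartiteDRG

end Eigenvalues

section Spectrum

open Matrix

variable {X : Type*} [Fintype X] [DecidableEq X]

lemma aeval_eq_zero_of_eval_eigenvalues_eq_zero {M : Matrix X X ℝ} (hM : M.IsHermitian) {p : ℝ[X]}
    (hp : ∀ i, p.eval (hM.eigenvalues i) = 0) : Polynomial.aeval M p = 0 := by
  refine toLin'.injective
    ((hM.eigenvectorBasis.toBasis.map (WithLp.linearEquiv 2 ℝ (X → ℝ))).ext fun i => ?_)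
  simp [aeval_mulVec_of_mulVec_eq_smul (hM.mulVec_eigenvectorBasis i), hp]

variable {G : SimpleGraph X} [DecidableRel G.Adj]

lemma aeval_adjMatrix_prod_eigenvalueSet :
    Polynomial.aeval (G.adjMatrix ℝ) (∏ θ ∈ eigenvalueSet G, (Polynomial.X - Polynomial.C θ)) =
      0 := by
  have hA : (G.adjMatrix ℝ).IsHermitian := by
    rw [IsHermitian, conjTranspose_eq_transpose_of_trivial, SimpleGraph.transpose_adjMatrix]
  refine aeval_eq_zero_of_eval_eigenvalues_eq_zero hA fun i => ?_
  have hmem : hA.eigenvalues i ∈ eigenvalueSet G := by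
    rw [eigenvalueSet, Set.Finite.mem_toFinset, Set.mem_ofPred_eq,
      Module.End.hasEigenvalue_iff_mem_spectrum, spectrum_toLin']
    exact hA.eigenvalues_mem_spectrum_real i
  rw [Polynomial.eval_prod]
  exact Finset.prod_eq_zero hmem (by simp)

lemma adjMatrix_pow_apply_eq_zero_of_lt_dist {i : ℕ} {y z : X} (hi : i < G.dist y z) :
    (G.adjMatrix ℝ ^ i) y z = 0 := by
  rw [SimpleGraph.adjMatrix_pow_apply_eq_card_walk, Nat.cast_eq_zero, Fintype.card_eq_zero_iff]
  exact ⟨fun p => hi.not_ge (p.2 ▸ G.dist_le p.1)⟩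

lemma adjMatrix_pow_dist_apply_ne_zero (hG : G.Connected) (y z : X) :
    (G.adjMatrix ℝ ^ G.dist y z) y z ≠ 0 := by
  obtain ⟨p, hp⟩ := hG.exists_walk_length_eq_dist y z
  rw [SimpleGraph.adjMatrix_pow_apply_eq_card_walk, Nat.cast_ne_zero]
  exact (Fintype.card_pos_iff.2 ⟨⟨p, hp⟩⟩).ne'

lemma diam_lt_natDegree_of_aeval_adjMatrix_eq_zero (hG : G.Connected) {p : ℝ[X]} (hp : p ≠ 0)
    (hroot : Polynomial.aeval (G.adjMatrix ℝ) p = 0) : G.diam < p.natDegree := by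
  by_contra! hle
  obtain ⟨y, z, hyz⟩ := exists_dist_eq hG hle
  have hentry := congrFun (congrFun hroot y) z
  rw [Polynomial.aeval_eq_sum_range, Finset.sum_range_succ, Matrix.add_apply,
    Matrix.sum_apply, Finset.sum_eq_zero, zero_add, ← hyz] at hentry
  · exact mul_ne_zero (by simpa [hyz] using hp) (adjMatrix_pow_dist_apply_ne_zero hG y z) hentry
  · intro i hi
    rw [Matrix.smul_apply, adjMatrix_pow_apply_eq_zero_of_lt_dist (hyz ▸ Finset.mem_range.1 hi),
      smul_zero]

lemma diam_lt_card_eigenvalueSet (hG : G.Connected) : G.diam < (eigenvalueSet G).card := by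
  have hdeg := diam_lt_natDegree_of_aeval_adjMatrix_eq_zero hG
    (Polynomial.monic_prod_X_sub_C _ _).ne_zero aeval_adjMatrix_prod_eigenvalueSet
  rwa [Polynomial.natDegree_finsetProd_X_sub_C_eq_card] at hdeg

lemma neg_mem_eigenvalueSet (hbip : G.IsBipartite) {θ : ℝ} (hθ : θ ∈ eigenvalueSet G) :
    -θ ∈ eigenvalueSet G := by
  obtain ⟨color⟩ := hbip
  obtain ⟨w, hw0, hw⟩ := mem_eigenvalueSet_iff.1 hθ
  have hsign : ∀ {y z}, G.Adj y z → (-1 : ℝ) ^ (color z : ℕ) = -(-1) ^ (color y : ℕ) := by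
    intro y z hyz
    have hne := color.valid hyz
    generalize color y = a, color z = b at hne
    fin_cases a <;> fin_cases b <;> simp at hne ⊢
  refine mem_eigenvalueSet_iff.2 ⟨fun z => (-1) ^ (color z : ℕ) * w z, fun h0 => hw0 ?_, ?_⟩
  · ext z
    simpa using congrFun h0 z
  · ext y
    have hy := congrFun hw y
    rw [SimpleGraph.adjMatrix_mulVec_apply, Pi.smul_apply, smul_eq_mul] at hy ⊢
    rw [Finset.sum_congr rfl fun z hz => by rw [hsign ((G.mem_neighborFinset _ _).1 hz)],
      ← Finset.mul_sum, hy]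
    ring

lemma IsDistanceRegular.valency_mem_eigenvalueSet (h : IsDistanceRegular G) :
    (b G 0 : ℝ) ∈ eigenvalueSet G := by
  have := h.connected.nonempty
  refine mem_eigenvalueSet_iff.2 ⟨1, one_ne_zero, ?_⟩
  ext y
  simp [SimpleGraph.adjMatrix_mulVec_apply, h.degree_eq]

lemma exists_theta_eq {θ : ℝ} (hθ : θ ∈ eigenvalueSet G) :
    ∃ i < (eigenvalueSet G).card, theta G i = θ := by
  obtain ⟨i, hi, rfl⟩ := List.getElem_of_mem ((Finset.mem_sort (· ≥ ·)).2 hθ)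
  exact ⟨i, by simpa using hi, List.getD_eq_getElem _ _ hi⟩

lemma theta_mem {i : ℕ} (hi : i < (eigenvalueSet G).card) : theta G i ∈ eigenvalueSet G := by
  rw [theta, List.getD_eq_getElem _ _ (by simpa using hi)]
  exact (Finset.mem_sort (· ≥ ·)).1 (List.getElem_mem _)

lemma strictAntiOn_theta : StrictAntiOn (theta G) (Set.Iio (eigenvalueSet G).card) := by
  intro i hi j hj hij
  rw [theta, theta, List.getD_eq_getElem _ _ (by simpa using hj),
    List.getD_eq_getElem _ _ (by simpa using hi)]
  exact (Finset.sortedGT_sort (eigenvalueSet G)).getElem_gt_getElem_of_lt hij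

lemma theta_eq_neg_theta (hbip : G.IsBipartite) {i j : ℕ}
    (hij : i + j + 1 = (eigenvalueSet G).card) : theta G j = -theta G i := by
  set l := (eigenvalueSet G).sort (· ≥ ·) with hl
  have hlen : l.length = i + j + 1 := by rw [hl, Finset.length_sort, hij]
  have hsorted : l.SortedGT := Finset.sortedGT_sort _
  have hrefl : l = (l.map Neg.neg).reverse := by
    refine hsorted.eq_reverse_of_mem_iff_of_sortedLT ?_ ?_
    · intro t
      rw [List.mem_map]
      simp only [hl, Finset.mem_sort]
      exact ⟨fun ht => ⟨-t, neg_mem_eigenvalueSet hbip ht, neg_neg t⟩,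
        fun ⟨s, hs, hst⟩ => hst ▸ neg_mem_eigenvalueSet hbip hs⟩
    · rw [List.sortedLT_iff_pairwise, List.pairwise_map]
      exact hsorted.pairwise.imp fun hst => neg_lt_neg hst
  have hindex : l.length - 1 - j = i := by lia
  calc theta G j = l[j] := List.getD_eq_getElem _ _ _
    _ = (l.map Neg.neg).reverse[j]'(by simp [hlen]) := List.getElem_of_eq hrefl _
    _ = -l[i] := by simp [hindex]
    _ = -theta G i := by rw [theta, List.getD_eq_getElem]

namespace IsBipartiteDRG

lemma roots_pPoly_toFinset (h : IsBipartiteDRG G) (hD : 2 ≤ G.diam) :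
    (pPoly G (G.diam - 1)).roots.toFinset = eigenvalueSet G \ {(b G 0 : ℝ), -(b G 0 : ℝ)} := by
  refine (Finset.eq_of_subset_of_card_le (fun t ht => ?_) ?_).symm
  · simp only [Finset.mem_sdiff, Finset.mem_insert, Finset.mem_singleton, not_or] at ht
    rw [Multiset.mem_toFinset, Polynomial.mem_roots (h.pPoly_ne_zero (Nat.sub_le _ _))]
    exact h.eval_pPoly_eq_zero_of_mem_eigenvalueSet hD ht.1 ht.2.1 ht.2.2
  · have hroots := h.card_roots_pPoly_toFinset_le (by lia)
    have hcard := Finset.le_card_sdiff {(b G 0 : ℝ), -(b G 0 : ℝ)} (eigenvalueSet G)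
    have htwo := Finset.card_le_two (a := (b G 0 : ℝ)) (b := -(b G 0 : ℝ))
    have hlt := diam_lt_card_eigenvalueSet h.connected
    lia

lemma card_eigenvalueSet (h : IsBipartiteDRG G) (hD : 2 ≤ G.diam) :
    (eigenvalueSet G).card = G.diam + 1 := by
  have hroots := h.card_roots_pPoly_toFinset_le (by lia)
  rw [h.roots_pPoly_toFinset hD] at hroots
  have hcard := Finset.le_card_sdiff {(b G 0 : ℝ), -(b G 0 : ℝ)} (eigenvalueSet G)
  have htwo := Finset.card_le_two (a := (b G 0 : ℝ)) (b := -(b G 0 : ℝ))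
  have hlt := diam_lt_card_eigenvalueSet h.connected
  lia

lemma theta_neg (h : IsBipartiteDRG G) (hD : 2 ≤ G.diam) {i : ℕ} (hi : i ≤ G.diam) :
    theta G (G.diam - i) = -theta G i :=
  theta_eq_neg_theta h.bipartite (by rw [h.card_eigenvalueSet hD]; lia)

lemma theta_lt_theta (h : IsBipartiteDRG G) (hD : 2 ≤ G.diam) {i j : ℕ} (hij : i < j)
    (hj : j ≤ G.diam) : theta G j < theta G i := by
  have hcard := h.card_eigenvalueSet hD
  exact strictAntiOn_theta (Set.mem_Iio.2 (by lia)) (Set.mem_Iio.2 (by lia)) hij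

lemma theta_le_theta (h : IsBipartiteDRG G) (hD : 2 ≤ G.diam) {i j : ℕ} (hij : i ≤ j)
    (hj : j ≤ G.diam) : theta G j ≤ theta G i := by
  rcases hij.eq_or_lt with rfl | hij
  · exact le_rfl
  · exact (h.theta_lt_theta hD hij hj).le

lemma theta_zero (h : IsBipartiteDRG G) (hD : 2 ≤ G.diam) : theta G 0 = b G 0 := by
  have hcard := h.card_eigenvalueSet hD
  refine le_antisymm ((le_abs_self _).trans
    (h.distanceRegular.abs_le_valency (theta_mem (by lia)))) ?_
  obtain ⟨j, hj, hjk⟩ := exists_theta_eq h.distanceRegular.valency_mem_eigenvalueSet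
  exact hjk ▸ h.theta_le_theta hD j.zero_le (by lia)

lemma abs_theta_lt (h : IsBipartiteDRG G) (hD : 2 ≤ G.diam) {i : ℕ} (hi0 : 0 < i)
    (hi : i < G.diam) : |theta G i| < b G 0 := by
  have hlast := h.theta_neg hD (Nat.zero_le _)
  rw [Nat.sub_zero] at hlast
  rw [abs_lt, ← h.theta_zero hD, ← hlast]
  exact ⟨h.theta_lt_theta hD hi le_rfl, h.theta_lt_theta hD hi0 hi.le⟩

lemma exists_theta_eq_of_eval_pPoly_eq_zero (h : IsBipartiteDRG G) (hD : 2 ≤ G.diam) {t : ℝ}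
    (ht : (pPoly G (G.diam - 1)).eval t = 0) : ∃ i ≤ G.diam, theta G i = t := by
  have hmem : t ∈ (pPoly G (G.diam - 1)).roots.toFinset :=
    Multiset.mem_toFinset.2 ((Polynomial.mem_roots (h.pPoly_ne_zero (Nat.sub_le _ _))).2 ht)
  rw [h.roots_pPoly_toFinset hD, Finset.mem_sdiff] at hmem
  obtain ⟨i, hi, rfl⟩ := exists_theta_eq hmem.1
  exact ⟨i, by rw [h.card_eigenvalueSet hD] at hi; lia, rfl⟩

lemma eval_pPoly_theta (h : IsBipartiteDRG G) (hD : 2 ≤ G.diam) {i : ℕ} (hi0 : 0 < i)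
    (hi : i < G.diam) : (pPoly G (G.diam - 1)).eval (theta G i) = 0 := by
  have habs := abs_lt.1 (h.abs_theta_lt hD hi0 hi)
  exact h.eval_pPoly_eq_zero_of_mem_eigenvalueSet hD
    (theta_mem (by rw [h.card_eigenvalueSet hD]; lia)) habs.2.ne habs.1.ne'

lemma eval_pPoly_theta_one_ne_zero (h : IsBipartiteDRG G) (hD : 2 ≤ G.diam) {i : ℕ}
    (hi : i < G.diam - 1) : (pPoly G i).eval (theta G 1) ≠ 0 := by
  have hlt := (abs_lt.1 (h.abs_theta_lt hD one_pos (by lia))).2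
  refine ((h.isSymmetricThreeTerm (by lia)).eval_pos_of_forall_ne_zero
    (fun j hj => h.eval_pPoly_valency_pos (by lia)) hi le_rfl hlt fun t ht ht0 => ?_).ne'
  obtain ⟨j, hj, rfl⟩ := h.exists_theta_eq_of_eval_pPoly_eq_zero hD ht0
  rcases Nat.eq_zero_or_pos j with rfl | hj0
  · rw [h.theta_zero hD] at ht0
    exact (h.eval_pPoly_valency_pos (by lia)).ne' ht0
  · exact (h.theta_le_theta hD hj0 hj).not_gt ht.1

lemma eval_pPoly_theta_half_ne_zero (h : IsBipartiteDRG G) (hD : 2 ≤ G.diam) (hodd : Odd G.diam)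
    {i : ℕ} (hi : i < G.diam - 1) : (pPoly G i).eval (theta G (G.diam / 2)) ≠ 0 := by
  obtain ⟨m, hm⟩ := hodd
  have hhalf : G.diam / 2 = m := by lia
  have hneg : theta G (m + 1) = -theta G m := by
    rw [← h.theta_neg hD (by lia), show G.diam - m = m + 1 by lia]
  have hdecr := h.theta_lt_theta hD m.lt_succ_self (by lia)
  have hm1 : G.diam - 1 = 2 * m := by lia
  rw [hhalf]
  refine (h.isSymmetricThreeTerm (by lia)).eval_ne_zero_of_forall_even_ne_zero hm1.ge
    (by linarith) (fun t ht ht0 => ?_) (hm1 ▸ hi)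
  obtain ⟨j, hj, rfl⟩ := h.exists_theta_eq_of_eval_pPoly_eq_zero hD (hm1 ▸ ht0)
  rcases le_or_gt j m with hjm | hjm
  · exact (h.theta_le_theta hD hjm (by lia)).not_gt ht.2
  · linarith [ht.1, h.theta_le_theta hD hjm hj]

end IsBipartiteDRG

end Spectrum

section Layers

variable {X : Type*} [Fintype X] [DecidableEq X] {G : SimpleGraph X}

lemma Estar_mul_Estar (x : X) (i j : ℕ) :
    Estar G x i * Estar G x j = if i = j then Estar G x i else 0 := by
  rw [Estar, Estar, Matrix.diagonal_mul_diagonal, ← Matrix.diagonal_zero]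
  split_ifs with hij
  · simp [hij]
  · congr
    grind

lemma Estar_mul_distMatrix_mul_Estar_eq_zero (hG : G.Connected) (x : X) {i j l : ℕ}
    (hij : i + l < j ∨ j + l < i ∨ i + j < l) : Estar G x i * distMatrix G j * Estar G x l = 0 := by
  ext y z
  simp only [Estar, distMatrix, Matrix.mul_diagonal, Matrix.diagonal_mul, Matrix.of_apply,
    Matrix.zero_apply, mul_ite, mul_one, mul_zero]
  refine ite_eq_right_iff.2 fun hz => ite_eq_right_iff.2 fun hyz => ite_eq_right_iff.2 fun hy => ?_
  have h1 := hG.dist_triangle (u := x) (v := y) (w := z)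
  have h2 := hG.dist_triangle (u := y) (v := x) (w := z)
  have h3 := hG.dist_triangle (u := x) (v := z) (w := y)
  rw [G.dist_comm (u := y) (v := x)] at h2
  rw [G.dist_comm (u := z) (v := y)] at h3
  lia

lemma Estar_mul_distMatrix_add_mul_Estar_two (hG : G.Connected) (hbip : G.IsBipartite) (x : X)
    (i : ℕ) :
    Estar G x (i + 2) * (distMatrix G i + distMatrix G (i + 2) + distMatrix G (i + 4)) *
      Estar G x 2 = Estar G x (i + 2) * (Matrix.of fun _ _ => 1) * Estar G x 2 := by
  ext y z
  simp only [Estar, distMatrix, Matrix.mul_diagonal, Matrix.diagonal_mul, Matrix.of_apply,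
    Matrix.add_apply]
  by_cases hy : G.dist x y = i + 2
  swap
  · simp [hy]
  by_cases hz : G.dist x z = 2
  swap
  · simp [hz]
  obtain ⟨r, hr⟩ := even_dist_add hG hbip x y z
  have hyz := hG.dist_triangle (u := y) (v := x) (w := z)
  have hxy := hG.dist_triangle (u := x) (v := z) (w := y)
  rw [G.dist_comm (u := y) (v := x)] at hyz
  rw [G.dist_comm (u := z) (v := y)] at hxy
  obtain h | h | h : G.dist y z = i ∨ G.dist y z = i + 2 ∨ G.dist y z = i + 4 := by lia
  all_goals simp [h]

variable [DecidableRel G.Adj]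

lemma adjMatrix_mul_Estar_succ (hG : G.Connected) (hbip : G.IsBipartite) (x : X) (i : ℕ) :
    G.adjMatrix ℂ * Estar G x (i + 1) =
      (Estar G x i + Estar G x (i + 2)) * G.adjMatrix ℂ * Estar G x (i + 1) := by
  ext y z
  simp only [Estar, Matrix.diagonal_add, Matrix.mul_diagonal, Matrix.diagonal_mul,
    SimpleGraph.adjMatrix_apply]
  by_cases hyz : G.Adj y z
  · have := dist_eq_succ_or_succ_eq hG hbip hyz x
    rw [G.dist_comm (u := z), G.dist_comm (u := y)] at this
    split_ifs <;> first | lia | simp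
  · simp [hyz]

lemma Estar_succ_mul_adjMatrix (hG : G.Connected) (hbip : G.IsBipartite) (x : X) (i : ℕ) :
    Estar G x (i + 1) * G.adjMatrix ℂ =
      Estar G x (i + 1) * G.adjMatrix ℂ * (Estar G x i + Estar G x (i + 2)) := by
  have hEstar : ∀ l, (Estar G x l).transpose = Estar G x l := fun _ => Matrix.diagonal_transpose _
  simpa [Matrix.transpose_mul, hEstar, mul_assoc] using
    congrArg Matrix.transpose (adjMatrix_mul_Estar_succ hG hbip x i)

end Layers

section LayerVectors

variable {X : Type*} [Fintype X] [DecidableEq X]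

/-- The adjacency matrix as an operator on the standard module. -/
noncomputable abbrev adjOp (G : SimpleGraph X) [DecidableRel G.Adj] :
    EuclideanSpace ℂ X →ₗ[ℂ] EuclideanSpace ℂ X :=
  Matrix.toEuclideanLin (G.adjMatrix ℂ)

/-- The dual idempotent `E*_i` as an operator on the standard module. -/
noncomputable abbrev layerProj (G : SimpleGraph X) (x : X) (i : ℕ) :
    EuclideanSpace ℂ X →ₗ[ℂ] EuclideanSpace ℂ X :=
  Matrix.toEuclideanLin (Estar G x i)

/-- The vector `E*_i A_j v`. In particular `basisVec G x v i` is `layerVec G x v (i + 2) i`. -/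
noncomputable abbrev layerVec (G : SimpleGraph X) (x : X) (v : EuclideanSpace ℂ X) (i j : ℕ) :
    EuclideanSpace ℂ X :=
  Matrix.toEuclideanLin (Estar G x i * distMatrix G j) v

variable {G : SimpleGraph X}

lemma toEuclideanLin_mul_apply (M N : Matrix X X ℂ) (w : EuclideanSpace ℂ X) :
    Matrix.toEuclideanLin (M * N) w = Matrix.toEuclideanLin M (Matrix.toEuclideanLin N w) := by
  rw [Matrix.toLpLin_mul_same, LinearMap.comp_apply]

lemma layerProj_layerProj (x : X) (i j : ℕ) (w : EuclideanSpace ℂ X) :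
    layerProj G x i (layerProj G x j w) = if i = j then layerProj G x i w else 0 := by
  rw [← toEuclideanLin_mul_apply, Estar_mul_Estar]
  split_ifs <;> simp

lemma layerProj_layerVec (x : X) (v : EuclideanSpace ℂ X) (i l j : ℕ) :
    layerProj G x i (layerVec G x v l j) = if i = l then layerVec G x v l j else 0 := by
  rw [layerVec, toEuclideanLin_mul_apply, layerProj_layerProj]
  split_ifs with h <;> simp [h]

lemma layerProj_isSymmetric (x : X) (i : ℕ) : (layerProj G x i).IsSymmetric := by
  rw [Matrix.isSymmetric_toEuclideanLin_iff, Estar, Matrix.isHermitian_diagonal_iff]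
  intro y
  split_ifs <;> simp [IsSelfAdjoint]

lemma inner_eq_zero_of_layerProj_eq {x : X} {i j : ℕ} (hij : i ≠ j) {u w : EuclideanSpace ℂ X}
    (hu : layerProj G x i u = u) (hw : layerProj G x j w = w) : inner ℂ u w = 0 := by
  rw [← hu, ← hw, layerProj_isSymmetric, layerProj_layerProj, if_neg hij, inner_zero_right]

lemma layerVec_eq_zero (hG : G.Connected) {x : X} {v : EuclideanSpace ℂ X} {i j l : ℕ}
    (hv : layerProj G x l v = v) (hij : i + l < j ∨ j + l < i ∨ i + j < l) :
    layerVec G x v i j = 0 := by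
  rw [← hv, layerVec, ← toEuclideanLin_mul_apply, Estar_mul_distMatrix_mul_Estar_eq_zero hG x hij,
    map_zero, LinearMap.zero_apply]

variable [DecidableRel G.Adj]

lemma adjOp_isSymmetric : (adjOp G).IsSymmetric := by
  rw [Matrix.isSymmetric_toEuclideanLin_iff, Matrix.IsHermitian]
  ext y z
  simp [SimpleGraph.adjMatrix_apply, SimpleGraph.adj_comm]

namespace IsBipartiteDRG

lemma layerProj_adjOp (h : IsBipartiteDRG G) (x : X) (i : ℕ) (w : EuclideanSpace ℂ X) :
    layerProj G x (i + 1) (adjOp G w) =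
      layerProj G x (i + 1) (adjOp G (layerProj G x i w)) +
        layerProj G x (i + 1) (adjOp G (layerProj G x (i + 2) w)) := by
  simp only [← toEuclideanLin_mul_apply, ← LinearMap.add_apply, ← map_add]
  rw [Estar_succ_mul_adjMatrix h.connected h.bipartite, mul_add, mul_assoc, mul_assoc]

lemma adjOp_eq_add_of_layerProj_eq (h : IsBipartiteDRG G) {x : X} {i : ℕ}
    {w : EuclideanSpace ℂ X} (hw : layerProj G x (i + 1) w = w) :
    adjOp G w = layerProj G x i (adjOp G w) + layerProj G x (i + 2) (adjOp G w) := by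
  nth_rw 1 [← hw]
  rw [← toEuclideanLin_mul_apply, adjMatrix_mul_Estar_succ h.connected h.bipartite]
  simp only [add_mul, map_add, LinearMap.add_apply, toEuclideanLin_mul_apply, hw]

lemma layerProj_adjOp_layerVec_zero (h : IsBipartiteDRG G) (x : X) (v : EuclideanSpace ℂ X)
    (i : ℕ) :
    layerProj G x (i + 1) (adjOp G (layerVec G x v i 0)) +
      layerProj G x (i + 1) (adjOp G (layerVec G x v (i + 2) 0)) = layerVec G x v (i + 1) 1 := by
  rw [layerVec, layerVec, layerVec, distMatrix_zero h.connected, distMatrix_one, mul_one, mul_one,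
    toEuclideanLin_mul_apply, ← h.layerProj_adjOp]

lemma layerProj_adjOp_layerVec_succ (h : IsBipartiteDRG G) (x : X) (v : EuclideanSpace ℂ X)
    (i j : ℕ) :
    layerProj G x (i + 1) (adjOp G (layerVec G x v i (j + 1))) +
        layerProj G x (i + 1) (adjOp G (layerVec G x v (i + 2) (j + 1))) =
      (b G j : ℂ) • layerVec G x v (i + 1) j + (c G (j + 2) : ℂ) • layerVec G x v (i + 1) (j + 2)
      := by
  rw [layerVec, layerVec, toEuclideanLin_mul_apply (Estar G x i),
    toEuclideanLin_mul_apply (Estar G x (i + 2)), ← h.layerProj_adjOp, adjOp,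
    ← toEuclideanLin_mul_apply (G.adjMatrix ℂ), h.adjMatrix_mul_distMatrix,
    ← toEuclideanLin_mul_apply, mul_add, Matrix.mul_smul, Matrix.mul_smul,
    ← Nat.cast_smul_eq_nsmul ℂ, ← Nat.cast_smul_eq_nsmul ℂ, map_add, map_smul, map_smul]
  rfl

end IsBipartiteDRG

end LayerVectors

section EndpointTwo

variable {X : Type*} [Fintype X] [DecidableEq X]

/-- The properties of a vector `v` of `E*_2 W` that follow from `W` having endpoint `2`:
`v` lies in the layer of index `2`, is orthogonal to the all-ones vector, and is annihilated by
`E*_1 A`. -/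
structure IsEndpointTwo (G : SimpleGraph X) (x : X) (v : EuclideanSpace ℂ X) : Prop where
  layerProj_two : layerProj G x 2 v = v
  layerVec_one_one : layerVec G x v 1 1 = 0
  sum_eq_zero : ∑ z, v z = 0

variable {G : SimpleGraph X} {x : X} {v : EuclideanSpace ℂ X}

lemma layerProj_basisVec (i j : ℕ) :
    layerProj G x i (basisVec G x v j) = if i = j + 2 then basisVec G x v j else 0 :=
  layerProj_layerVec x v i (j + 2) j

lemma layerProj_basisVec_self (j : ℕ) :
    layerProj G x (j + 2) (basisVec G x v j) = basisVec G x v j := by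
  rw [layerProj_basisVec, if_pos rfl]

lemma inner_basisVec_eq_zero {i j : ℕ} (hij : i ≠ j) :
    inner ℂ (basisVec G x v i) (basisVec G x v j) = 0 :=
  inner_eq_zero_of_layerProj_eq (by lia) (layerProj_basisVec_self i) (layerProj_basisVec_self j)

namespace IsEndpointTwo

lemma basisVec_zero (hv : IsEndpointTwo G x v) (hG : G.Connected) : basisVec G x v 0 = v := by
  rw [basisVec, distMatrix_zero hG, mul_one]
  exact hv.layerProj_two

lemma layerVec_add_add (hv : IsEndpointTwo G x v) (hG : G.Connected) (hbip : G.IsBipartite)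
    (i : ℕ) :
    layerVec G x v (i + 2) i + layerVec G x v (i + 2) (i + 2) + layerVec G x v (i + 2) (i + 4) =
      0 := by
  have hones : Matrix.toEuclideanLin (Matrix.of fun _ _ : X => (1 : ℂ)) v = 0 := by
    ext y
    simpa [Matrix.toLpLin_apply, Matrix.mulVec, dotProduct] using hv.sum_eq_zero
  calc _ = Matrix.toEuclideanLin (Estar G x (i + 2) *
        (distMatrix G i + distMatrix G (i + 2) + distMatrix G (i + 4)) * Estar G x 2) v := by
        rw [toEuclideanLin_mul_apply _ (Estar G x 2), hv.layerProj_two]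
        simp only [mul_add, map_add, LinearMap.add_apply]
    _ = 0 := by
      rw [Estar_mul_distMatrix_add_mul_Estar_two hG hbip, toEuclideanLin_mul_apply,
        hv.layerProj_two, toEuclideanLin_mul_apply, hones, map_zero]

variable [DecidableRel G.Adj]

lemma layerProj_one_adjOp (hv : IsEndpointTwo G x v) (h : IsBipartiteDRG G) :
    layerProj G x 1 (adjOp G (basisVec G x v 0)) = 0 := by
  have hrel := h.layerProj_adjOp_layerVec_zero x v 0
  rw [layerVec_eq_zero h.connected hv.layerProj_two (by lia), map_zero, map_zero, zero_add,
    hv.layerVec_one_one] at hrel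
  exact hrel

lemma layerProj_adjOp_raise (hv : IsEndpointTwo G x v) (h : IsBipartiteDRG G)
    (hdiam : 0 < G.diam) (j : ℕ) :
    layerProj G x (j + 3) (adjOp G (basisVec G x v j)) =
      (c G (j + 1) : ℂ) • basisVec G x v (j + 1) := by
  have hvanish {i l : ℕ} (hil : l + 2 < i) : layerVec G x v i l = 0 :=
    layerVec_eq_zero h.connected hv.layerProj_two (.inr (.inl hil))
  cases j with
  | zero =>
    have hrel := h.layerProj_adjOp_layerVec_zero x v 2
    rw [hvanish (i := 2 + 2) (by lia), map_zero, map_zero, add_zero] at hrel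
    rw [h.distanceRegular.c_one hdiam, Nat.cast_one, one_smul]
    exact hrel
  | succ j =>
    have hrel := h.layerProj_adjOp_layerVec_succ x v (j + 3) j
    rw [hvanish (i := j + 3 + 2) (by lia), hvanish (i := j + 3 + 1) (l := j) (by lia), map_zero,
      map_zero, add_zero, smul_zero, zero_add] at hrel
    exact hrel

lemma layerProj_adjOp_lower (hv : IsEndpointTwo G x v) (h : IsBipartiteDRG G) (j : ℕ) :
    layerProj G x (j + 2) (adjOp G (layerVec G x v (j + 3) (j + 5))) =
      (b G (j + 4) : ℂ) • layerVec G x v (j + 2) (j + 4) := by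
  have hvanish {i l : ℕ} (hil : i + 2 < l) : layerVec G x v i l = 0 :=
    layerVec_eq_zero h.connected hv.layerProj_two (.inl hil)
  have hrel := h.layerProj_adjOp_layerVec_succ x v (j + 1) (j + 4)
  rw [hvanish (i := j + 1) (by lia), hvanish (i := j + 1 + 1) (l := j + 4 + 2) (by lia), map_zero,
    map_zero, zero_add, smul_zero, add_zero] at hrel
  exact hrel

lemma layerProj_two_adjOp (hv : IsEndpointTwo G x v) (h : IsBipartiteDRG G)
    (hdiam : 2 ≤ G.diam) :
    layerProj G x 2 (adjOp G (basisVec G x v 1)) =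
      (b G 2 : ℂ) • basisVec G x v 0 - (c G 2 : ℂ) • layerVec G x v 2 4 := by
  have hrel : layerProj G x 2 (adjOp G (layerVec G x v 1 1)) +
      layerProj G x 2 (adjOp G (basisVec G x v 1)) =
        (b G 0 : ℂ) • basisVec G x v 0 + (c G 2 : ℂ) • layerVec G x v 2 2 :=
    h.layerProj_adjOp_layerVec_succ x v 1 0
  have hsum : basisVec G x v 0 + layerVec G x v 2 2 + layerVec G x v 2 4 = 0 :=
    hv.layerVec_add_add h.connected h.bipartite 0
  have hbc : (b G 2 : ℂ) + c G 2 = b G 0 := by exact_mod_cast h.b_add_c hdiam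
  rw [hv.layerVec_one_one, map_zero, map_zero, zero_add] at hrel
  linear_combination (norm := module) hrel + (c G 2 : ℂ) • hsum - hbc • basisVec G x v 0

lemma layerProj_adjOp_add_two (hv : IsEndpointTwo G x v) (h : IsBipartiteDRG G) {j : ℕ}
    (hj : j + 3 ≤ G.diam) :
    layerProj G x (j + 3) (adjOp G (basisVec G x v (j + 2))) =
      layerProj G x (j + 3) (adjOp G (layerVec G x v (j + 2) (j + 4))) +
        (b G (j + 3) : ℂ) • basisVec G x v (j + 1) -
        (c G (j + 3) : ℂ) • layerVec G x v (j + 3) (j + 5) := by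
  have hrel : layerProj G x (j + 3) (adjOp G (layerVec G x v (j + 2) (j + 2))) +
      layerProj G x (j + 3) (adjOp G (basisVec G x v (j + 2))) =
        (b G (j + 1) : ℂ) • basisVec G x v (j + 1) +
          (c G (j + 3) : ℂ) • layerVec G x v (j + 3) (j + 3) :=
    h.layerProj_adjOp_layerVec_succ x v (j + 2) (j + 1)
  have hsum : basisVec G x v j + layerVec G x v (j + 2) (j + 2) +
      layerVec G x v (j + 2) (j + 4) = 0 :=
    hv.layerVec_add_add h.connected h.bipartite j
  have hsum_succ : basisVec G x v (j + 1) + layerVec G x v (j + 3) (j + 3) +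
      layerVec G x v (j + 3) (j + 5) = 0 :=
    hv.layerVec_add_add h.connected h.bipartite (j + 1)
  have hraise := hv.layerProj_adjOp_raise h (by lia) j
  have hbc : (b G (j + 1) : ℂ) + c G (j + 1) = b G (j + 3) + c G (j + 3) := by
    exact_mod_cast (h.b_add_c (by lia)).trans (h.b_add_c hj).symm
  have himage := congrArg (fun w => layerProj G x (j + 3) (adjOp G w)) hsum
  simp only [map_add, map_zero] at himage
  linear_combination (norm := module) hrel - himage + hraise + hbc • basisVec G x v (j + 1) +
    (c G (j + 3) : ℂ) • hsum_succ

end IsEndpointTwo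

end EndpointTwo

section Scalars

variable {X : Type*} [Fintype X] {G : SimpleGraph X} {θ : ℝ}

/-- The scalar `r_j` with `E*_{j+2} A_{j+4} v = r_j E*_{j+2} A_j v`. -/
noncomputable def ratio (G : SimpleGraph X) (θ : ℝ) (j : ℕ) : ℝ :=
  b G (j + 2) * b G (j + 3) * (pPoly G j).eval θ /
    (c G (j + 1) * c G (j + 2) * (pPoly G (j + 2)).eval θ)

/-- The scalar `l_j` with `E*_{j+2} A E*_{j+3} A_{j+1} v = l_j E*_{j+2} A_j v`. -/
noncomputable def lowerScalar (G : SimpleGraph X) (θ : ℝ) (j : ℕ) : ℝ :=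
  b G (j + 2) * c G (j + 3) * (pPoly G (j + 3)).eval θ * (pPoly G j).eval θ /
    (c G (j + 1) * (pPoly G (j + 1)).eval θ * (pPoly G (j + 2)).eval θ)

/-- The square norm of `E*_{j+2} A_j v` for a unit vector `v`. -/
noncomputable def normFactor (G : SimpleGraph X) (θ : ℝ) (j : ℕ) : ℝ :=
  ((kval G j : ℝ) * b G j * b G (j + 1) * c G (j + 1) * c G (j + 2)) /
      ((b G 0 : ℝ) * b G 1 * (θ ^ 2 - b G 2)) *
    ((pPoly G (j + 2)).eval θ / (pPoly G j).eval θ)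

lemma lowerScalar_eq_zero {j : ℕ} (hroot : (pPoly G (j + 3)).eval θ = 0) :
    lowerScalar G θ j = 0 := by
  rw [lowerScalar, hroot]
  simp only [mul_zero, zero_mul, zero_div]

namespace IsDistanceRegular

lemma cast_b_ne_zero (h : IsDistanceRegular G) {i : ℕ} (hi : i < G.diam) : (b G i : ℝ) ≠ 0 :=
  Nat.cast_ne_zero.2 (h.b_pos hi).ne'

lemma cast_c_succ_ne_zero (h : IsDistanceRegular G) {i : ℕ} (hi : i < G.diam) :
    (c G (i + 1) : ℝ) ≠ 0 :=
  Nat.cast_ne_zero.2 (h.c_succ_pos hi).ne'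

end IsDistanceRegular

namespace IsBipartiteDRG

lemma c_two_mul_eval_pPoly_two (h : IsBipartiteDRG G) (hD : 2 ≤ G.diam) (θ : ℝ) :
    (c G 2 : ℝ) * (pPoly G 2).eval θ = θ ^ 2 - b G 2 := by
  have hrec := h.mul_eval_pPoly (i := 0) hD θ
  simp only [zero_add, pPoly_one, h.distanceRegular.fPoly_one (by lia), pPoly_zero,
    Polynomial.eval_X, Polynomial.eval_one] at hrec
  linear_combination -hrec

lemma sq_sub_ne_zero (h : IsBipartiteDRG G) (hD : 2 ≤ G.diam)
    (hp : (pPoly G 2).eval θ ≠ 0) : θ ^ 2 - (b G 2 : ℝ) ≠ 0 := by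
  rw [← h.c_two_mul_eval_pPoly_two hD]
  exact mul_ne_zero (h.distanceRegular.cast_c_succ_ne_zero hD) hp

lemma denominator_ne_zero (h : IsBipartiteDRG G) (hD : 2 ≤ G.diam)
    (hp : (pPoly G 2).eval θ ≠ 0) : (b G 0 : ℝ) * b G 1 * (θ ^ 2 - b G 2) ≠ 0 :=
  mul_ne_zero (mul_ne_zero (h.distanceRegular.cast_b_ne_zero (by lia))
    (h.distanceRegular.cast_b_ne_zero hD)) (h.sq_sub_ne_zero hD hp)

lemma ratio_zero (h : IsBipartiteDRG G) (hD : 2 ≤ G.diam) : ratio G θ 0 = -1 - tilde G θ := by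
  simp only [ratio, tilde, zero_add, h.distanceRegular.c_one (by lia), pPoly_zero,
    Polynomial.eval_one, Nat.cast_one, one_mul, mul_one, h.c_two_mul_eval_pPoly_two hD]
  ring

lemma normFactor_zero (h : IsBipartiteDRG G) (hD : 2 ≤ G.diam) (hp : (pPoly G 2).eval θ ≠ 0) :
    normFactor G θ 0 = 1 := by
  have hden := h.denominator_ne_zero hD hp
  rw [normFactor, pPoly_zero, Polynomial.eval_one, div_one, div_mul_eq_mul_div,
    div_eq_one_iff_eq hden, h.distanceRegular.kval_zero, h.distanceRegular.c_one (by lia),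
    ← h.c_two_mul_eval_pPoly_two hD]
  push_cast
  ring

lemma lowerScalar_zero (h : IsBipartiteDRG G) (hD : 3 ≤ G.diam)
    (hp : ∀ i < 3, (pPoly G i).eval θ ≠ 0) :
    lowerScalar G θ 0 = b G 2 - c G 2 * ratio G θ 0 := by
  have hrec := h.mul_eval_pPoly (i := 1) hD θ
  have hp1 := hp 1 (by lia)
  have hp2 := hp 2 (by lia)
  have hc := h.distanceRegular.cast_c_succ_ne_zero (i := 1) (by lia)
  simp only [lowerScalar, ratio, zero_add, h.distanceRegular.c_one (by lia), pPoly_zero,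
    Polynomial.eval_one, pPoly_one, h.distanceRegular.fPoly_one (by lia), Polynomial.eval_X,
    Nat.cast_one, one_mul, mul_one, Nat.reduceAdd] at *
  field_simp
  linear_combination -(b G 2 : ℝ) * hrec

lemma lowerScalar_succ (h : IsBipartiteDRG G) {j : ℕ} (hj : j + 5 ≤ G.diam)
    (hp : ∀ i < G.diam - 1, (pPoly G i).eval θ ≠ 0) :
    lowerScalar G θ (j + 1) =
      c G (j + 1) * ratio G θ j + b G (j + 3) - c G (j + 3) * ratio G θ (j + 1) := by
  have hrec := h.mul_eval_pPoly (i := j) (by lia) θ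
  have hrec_two := h.mul_eval_pPoly (i := j + 2) (by lia) θ
  have hp2 := hp (j + 2) (by lia)
  have hp3 := hp (j + 3) (by lia)
  have hc1 := h.distanceRegular.cast_c_succ_ne_zero (i := j) (by lia)
  have hc2 := h.distanceRegular.cast_c_succ_ne_zero (i := j + 1) (by lia)
  have hc3 := h.distanceRegular.cast_c_succ_ne_zero (i := j + 2) (by lia)
  simp only [lowerScalar, ratio, add_assoc, Nat.reduceAdd] at *
  field_simp
  linear_combination b G (j + 3) *
    ((pPoly G (j + 3)).eval θ * hrec - (pPoly G (j + 1)).eval θ * hrec_two)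

lemma lowerScalar_ne_zero (h : IsBipartiteDRG G) {j : ℕ} (hj : j + 5 ≤ G.diam)
    (hp : ∀ i < G.diam - 1, (pPoly G i).eval θ ≠ 0) : lowerScalar G θ j ≠ 0 := by
  have hb := h.distanceRegular.cast_b_ne_zero (i := j + 2) (by lia)
  have hc1 := h.distanceRegular.cast_c_succ_ne_zero (i := j) (by lia)
  have hc3 := h.distanceRegular.cast_c_succ_ne_zero (i := j + 2) (by lia)
  exact div_ne_zero (mul_ne_zero (mul_ne_zero (mul_ne_zero hb hc3) (hp _ (by lia)))
    (hp _ (by lia))) (mul_ne_zero (mul_ne_zero hc1 (hp _ (by lia))) (hp _ (by lia)))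

lemma ratio_succ_mul_lowerScalar (h : IsBipartiteDRG G) {j : ℕ} (hj : j + 5 ≤ G.diam)
    (hp : ∀ i < G.diam - 1, (pPoly G i).eval θ ≠ 0) :
    ratio G θ (j + 1) * lowerScalar G θ j = b G (j + 4) * ratio G θ j := by
  have hp1 := hp (j + 1) (by lia)
  have hp2 := hp (j + 2) (by lia)
  have hp3 := hp (j + 3) (by lia)
  have hc1 := h.distanceRegular.cast_c_succ_ne_zero (i := j) (by lia)
  have hc2 := h.distanceRegular.cast_c_succ_ne_zero (i := j + 1) (by lia)
  have hc3 := h.distanceRegular.cast_c_succ_ne_zero (i := j + 2) (by lia)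
  simp only [lowerScalar, ratio, add_assoc, Nat.reduceAdd] at *
  field_simp

lemma c_mul_normFactor_succ (h : IsBipartiteDRG G) {j : ℕ} (hj : j + 5 ≤ G.diam)
    (hp : ∀ i < G.diam - 1, (pPoly G i).eval θ ≠ 0) :
    c G (j + 1) * normFactor G θ (j + 1) = lowerScalar G θ j * normFactor G θ j := by
  have hden := h.denominator_ne_zero (by lia) (hp 2 (by lia))
  have hk : (kval G j : ℝ) * b G j = kval G (j + 1) * c G (j + 1) := by
    exact_mod_cast h.distanceRegular.kval_mul_b j
  have hp0 := hp j (by lia)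
  have hp1 := hp (j + 1) (by lia)
  have hp2 := hp (j + 2) (by lia)
  have hc1 := h.distanceRegular.cast_c_succ_ne_zero (i := j) (by lia)
  simp only [lowerScalar, normFactor, add_assoc, Nat.reduceAdd] at *
  rw [hk]
  generalize (b G 0 : ℝ) * b G 1 * (θ ^ 2 - b G 2) = K at *
  field_simp

end IsBipartiteDRG

end Scalars

section ThinEndpointTwo

variable {X : Type*} [Fintype X] [DecidableEq X]

/-- The properties of a nonzero vector `v` of `E*_2 W` that follow from `W` being thin with
endpoint `2` and local eigenvalue `η`: the vector `E*_{j+2} A_{j+4} v` lies on the line spanned by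
`E*_{j+2} A_j v`, whenever the latter is nonzero. -/
structure IsThinEndpointTwo (G : SimpleGraph X) (x : X) (v : EuclideanSpace ℂ X) (η : ℝ) : Prop
    extends IsEndpointTwo G x v where
  ne_zero : v ≠ 0
  layerVec_two_two : layerVec G x v 2 2 = (η : ℂ) • v
  exists_smul_eq (j : ℕ) :
    basisVec G x v j ≠ 0 → ∃ τ : ℂ, layerVec G x v (j + 2) (j + 4) = τ • basisVec G x v j

/-- The relations at the `j`-th vector `E*_{j+2} A_j v`, which determine one another from layer to
layer: it is nonzero, and `ratio` and `lowerScalar` are the scalars they are meant to be. -/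
structure LayerRelations (G : SimpleGraph X) [DecidableRel G.Adj] (x : X)
    (v : EuclideanSpace ℂ X) (θ : ℝ) (j : ℕ) : Prop where
  ne_zero : basisVec G x v j ≠ 0
  layerVec_eq : layerVec G x v (j + 2) (j + 4) = (ratio G θ j : ℂ) • basisVec G x v j
  layerProj_adjOp_eq : layerProj G x (j + 2) (adjOp G (basisVec G x v (j + 1))) =
    (lowerScalar G θ j : ℂ) • basisVec G x v j

variable {G : SimpleGraph X} {x : X} {v : EuclideanSpace ℂ X} {θ : ℝ}

namespace IsThinEndpointTwo

lemma layerVec_two_four (hv : IsThinEndpointTwo G x v (tilde G θ)) (h : IsBipartiteDRG G)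
    (hD : 2 ≤ G.diam) : layerVec G x v 2 4 = (ratio G θ 0 : ℂ) • basisVec G x v 0 := by
  have hsum : basisVec G x v 0 + layerVec G x v 2 2 + layerVec G x v 2 4 = 0 :=
    hv.layerVec_add_add h.connected h.bipartite 0
  have hratio : (ratio G θ 0 : ℂ) = -1 - tilde G θ := by exact_mod_cast h.ratio_zero hD
  rw [hv.layerVec_two_two, hv.basisVec_zero h.connected] at hsum
  rw [hv.basisVec_zero h.connected, hratio]
  linear_combination (norm := module) hsum

section

variable [DecidableRel G.Adj]

lemma layerRelations_zero (hv : IsThinEndpointTwo G x v (tilde G θ)) (h : IsBipartiteDRG G)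
    (hD : 3 ≤ G.diam) (hp : ∀ i < 3, (pPoly G i).eval θ ≠ 0) : LayerRelations G x v θ 0 where
  ne_zero := by
    rw [hv.basisVec_zero h.connected]
    exact hv.ne_zero
  layerVec_eq := hv.layerVec_two_four h (by lia)
  layerProj_adjOp_eq := by
    rw [hv.layerProj_two_adjOp h (by lia), hv.layerVec_two_four h (by lia),
      h.lowerScalar_zero hD hp]
    push_cast
    module

lemma layerVec_succ_eq (hv : IsThinEndpointTwo G x v (tilde G θ)) (h : IsBipartiteDRG G) {j : ℕ}
    (hj : j + 5 ≤ G.diam) (hp : ∀ i < G.diam - 1, (pPoly G i).eval θ ≠ 0)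
    (hrel : LayerRelations G x v θ j) (hne : basisVec G x v (j + 1) ≠ 0) :
    layerVec G x v (j + 3) (j + 5) = (ratio G θ (j + 1) : ℂ) • basisVec G x v (j + 1) := by
  obtain ⟨τ, hτ⟩ : ∃ τ : ℂ, layerVec G x v (j + 3) (j + 5) = τ • basisVec G x v (j + 1) :=
    hv.exists_smul_eq (j + 1) hne
  have hlower := hv.layerProj_adjOp_lower h j
  rw [hτ, map_smul, map_smul, hrel.layerProj_adjOp_eq, hrel.layerVec_eq, smul_smul,
    smul_smul] at hlower
  have hscalar : τ * lowerScalar G θ j = b G (j + 4) * ratio G θ j :=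
    smul_left_injective ℂ hrel.ne_zero hlower
  have hratio : (ratio G θ (j + 1) : ℂ) * lowerScalar G θ j = b G (j + 4) * ratio G θ j := by
    exact_mod_cast h.ratio_succ_mul_lowerScalar hj hp
  have hl : (lowerScalar G θ j : ℂ) ≠ 0 := Complex.ofReal_ne_zero.2 (h.lowerScalar_ne_zero hj hp)
  rw [hτ, mul_right_cancel₀ hl (hscalar.trans hratio.symm)]

lemma layerRelations_succ (hv : IsThinEndpointTwo G x v (tilde G θ)) (h : IsBipartiteDRG G)
    {j : ℕ} (hj : j + 5 ≤ G.diam) (hp : ∀ i < G.diam - 1, (pPoly G i).eval θ ≠ 0)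
    (hrel : LayerRelations G x v θ j) : LayerRelations G x v θ (j + 1) := by
  have hne : basisVec G x v (j + 1) ≠ 0 := by
    intro hzero
    have hlower := hrel.layerProj_adjOp_eq
    rw [hzero, map_zero, map_zero] at hlower
    exact smul_ne_zero (Complex.ofReal_ne_zero.2 (h.lowerScalar_ne_zero hj hp)) hrel.ne_zero
      hlower.symm
  have hlayer := hv.layerVec_succ_eq h hj hp hrel hne
  refine ⟨hne, hlayer, ?_⟩
  rw [hv.layerProj_adjOp_add_two h (by lia), hlayer, hrel.layerVec_eq, map_smul, map_smul,
    hv.layerProj_adjOp_raise h (by lia), h.lowerScalar_succ hj hp]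
  push_cast
  module

lemma layerRelations (hv : IsThinEndpointTwo G x v (tilde G θ)) (h : IsBipartiteDRG G)
    (hp : ∀ i < G.diam - 1, (pPoly G i).eval θ ≠ 0) {j : ℕ} (hj : j + 4 ≤ G.diam) :
    LayerRelations G x v θ j := by
  induction j with
  | zero => exact hv.layerRelations_zero h (by lia) fun i hi => hp i (by lia)
  | succ j ih => exact hv.layerRelations_succ h (by lia) hp (ih (by lia))

-- Both sides are `⟨u_{j+1}, A u_j⟩`, because `A` is symmetric.
lemma c_mul_norm_sq_basisVec_succ (hv : IsThinEndpointTwo G x v (tilde G θ))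
    (h : IsBipartiteDRG G) (hD : 0 < G.diam) {j : ℕ} (hrel : LayerRelations G x v θ j) :
    (c G (j + 1) : ℝ) * ‖basisVec G x v (j + 1)‖ ^ 2 =
      lowerScalar G θ j * ‖basisVec G x v j‖ ^ 2 := by
  have hraise : inner ℂ (basisVec G x v (j + 1)) (adjOp G (basisVec G x v j)) =
      c G (j + 1) * ‖basisVec G x v (j + 1)‖ ^ 2 := by
    rw [← layerProj_basisVec_self (j + 1), layerProj_isSymmetric, hv.layerProj_adjOp_raise h hD,
      inner_smul_right, layerProj_basisVec_self, inner_self_eq_norm_sq_to_K]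
    rfl
  have hlower : inner ℂ (adjOp G (basisVec G x v (j + 1))) (basisVec G x v j) =
      lowerScalar G θ j * ‖basisVec G x v j‖ ^ 2 := by
    rw [← layerProj_basisVec_self j, ← layerProj_isSymmetric, hrel.layerProj_adjOp_eq,
      inner_smul_left, Complex.conj_ofReal, layerProj_basisVec_self, inner_self_eq_norm_sq_to_K]
    rfl
  rw [adjOp_isSymmetric, hraise] at hlower
  exact_mod_cast hlower

lemma basisVec_succ_eq_zero (hv : IsThinEndpointTwo G x v (tilde G θ)) (h : IsBipartiteDRG G)
    {j : ℕ} (hj : j < G.diam) (hrel : LayerRelations G x v θ j)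
    (hroot : (pPoly G (j + 3)).eval θ = 0) : basisVec G x v (j + 1) = 0 := by
  have hnorm := hv.c_mul_norm_sq_basisVec_succ h (by lia) hrel
  rw [lowerScalar_eq_zero hroot, zero_mul] at hnorm
  have hc := h.distanceRegular.cast_c_succ_ne_zero hj
  exact norm_eq_zero.1 (eq_zero_of_pow_eq_zero ((mul_eq_zero.1 hnorm).resolve_left hc))

lemma adjOp_basisVec_zero (hv : IsThinEndpointTwo G x v (tilde G θ)) (h : IsBipartiteDRG G)
    (hD : 0 < G.diam) : adjOp G (basisVec G x v 0) = basisVec G x v 1 := by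
  rw [h.adjOp_eq_add_of_layerProj_eq (layerProj_basisVec_self 0), hv.layerProj_one_adjOp h,
    hv.layerProj_adjOp_raise h hD, h.distanceRegular.c_one hD, Nat.cast_one, one_smul, zero_add]

lemma adjOp_basisVec_succ (hv : IsThinEndpointTwo G x v (tilde G θ)) (h : IsBipartiteDRG G)
    (hD : 0 < G.diam) {j : ℕ} (hrel : LayerRelations G x v θ j) :
    adjOp G (basisVec G x v (j + 1)) =
      (lowerScalar G θ j : ℂ) • basisVec G x v j +
        (c G (j + 2) : ℂ) • basisVec G x v (j + 2) := by
  rw [h.adjOp_eq_add_of_layerProj_eq (layerProj_basisVec_self (j + 1)), hrel.layerProj_adjOp_eq,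
    hv.layerProj_adjOp_raise h hD]

end

lemma norm_sq_basisVec (hv : IsThinEndpointTwo G x v (tilde G θ)) (h : IsBipartiteDRG G)
    (hp : ∀ i < G.diam - 1, (pPoly G i).eval θ ≠ 0) {j : ℕ} (hj : j + 4 ≤ G.diam) :
    ‖basisVec G x v j‖ ^ 2 = normFactor G θ j * ‖v‖ ^ 2 := by
  classical
  induction j with
  | zero =>
    rw [hv.basisVec_zero h.connected, h.normFactor_zero (by lia) (hp 2 (by lia)), one_mul]
  | succ j ih =>
    have hc := h.distanceRegular.cast_c_succ_ne_zero (i := j) (by lia)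
    apply mul_left_cancel₀ hc
    rw [hv.c_mul_norm_sq_basisVec_succ h (by lia) (hv.layerRelations h hp (by lia)), ih (by lia),
      ← mul_assoc, ← mul_assoc, h.c_mul_normFactor_succ (by lia) hp]

lemma linearIndependent_basisVec (hv : IsThinEndpointTwo G x v (tilde G θ))
    (h : IsBipartiteDRG G) (hp : ∀ i < G.diam - 1, (pPoly G i).eval θ ≠ 0) :
    LinearIndependent ℂ fun i : Fin (G.diam - 3) => basisVec G x v i := by
  classical
  exact linearIndependent_of_ne_zero_of_inner_eq_zero
    (fun i => (hv.layerRelations h hp (by lia)).ne_zero)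
    fun _ _ hij => inner_basisVec_eq_zero (Fin.val_injective.ne hij)

end IsThinEndpointTwo

end ThinEndpointTwo

section TModules

variable {X : Type*} [Fintype X] [DecidableEq X] {G : SimpleGraph X} {x : X}
  {W : Submodule ℂ (EuclideanSpace ℂ X)} {v : EuclideanSpace ℂ X} {η θ : ℝ}

lemma exists_smul_eq_of_finrank_le_one {K V : Type*} [Field K] [AddCommGroup V] [Module K V]
    [FiniteDimensional K V] {S : Submodule K V} (hS : Module.finrank K S ≤ 1) {a u : V}
    (ha : a ∈ S) (ha_ne : a ≠ 0) (hu : u ∈ S) : ∃ τ : K, u = τ • a := by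
  have ha_ne' : (⟨a, ha⟩ : S) ≠ 0 := by simpa using ha_ne
  have : Nontrivial S := ⟨_, _, ha_ne'⟩
  obtain ⟨τ, hτ⟩ := exists_smul_eq_of_finrank_eq_one
    (le_antisymm hS Module.finrank_pos) ha_ne' ⟨u, hu⟩
  exact ⟨τ, (congrArg Subtype.val hτ).symm⟩

lemma layerProj_mem_subconst {w : EuclideanSpace ℂ X} (hw : w ∈ W) (i : ℕ) :
    layerProj G x i w ∈ subconst G x i W :=
  Submodule.mem_map_of_mem hw

lemma layerProj_eq_of_mem_subconst {i : ℕ} (hv : v ∈ subconst G x i W) :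
    layerProj G x i v = v := by
  obtain ⟨w, -, rfl⟩ := hv
  rw [layerProj_layerProj, if_pos rfl]

lemma subconst_eq_bot_of_lt_endpoint {i : ℕ} (hi : i < endpoint G x W) : subconst G x i W = ⊥ :=
  not_not.1 (Nat.notMem_of_lt_sInf hi)

lemma layerProj_apply (x : X) (i : ℕ) (w : EuclideanSpace ℂ X) (y : X) :
    layerProj G x i w y = if G.dist x y = i then w y else 0 := by
  simp [Matrix.toLpLin_apply, Estar, Matrix.mulVec_diagonal]

lemma layerVec_zero_apply_self {i : ℕ} (hv : layerProj G x i v = v) :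
    layerVec G x v 0 i x = ∑ z, v z := by
  calc layerVec G x v 0 i x = ∑ z, layerProj G x i v z := by
        rw [layerVec, toEuclideanLin_mul_apply, layerProj_apply, if_pos G.dist_self]
        simp only [layerProj_apply]
        simp [Matrix.toLpLin_apply, Matrix.mulVec, dotProduct, distMatrix]
    _ = ∑ z, v z := by rw [hv]

/-- The span of the first `m` of the vectors `E*_{i+2} A_i v`. -/
def basisSpan (G : SimpleGraph X) (x : X) (v : EuclideanSpace ℂ X) (m : ℕ) :
    Submodule ℂ (EuclideanSpace ℂ X) :=
  Submodule.span ℂ (Set.range fun i : Fin m => basisVec G x v i)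

lemma basisVec_mem_basisSpan {m j : ℕ} (hj : j < m) : basisVec G x v j ∈ basisSpan G x v m :=
  Submodule.subset_span ⟨⟨j, hj⟩, rfl⟩

lemma layerProj_mem_basisSpan {m : ℕ} (i : ℕ) {w : EuclideanSpace ℂ X}
    (hw : w ∈ basisSpan G x v m) : layerProj G x i w ∈ basisSpan G x v m := by
  refine Submodule.span_le (p := (basisSpan G x v m).comap (layerProj G x i)).2 ?_ hw
  rintro _ ⟨j, rfl⟩
  rw [SetLike.mem_coe, Submodule.mem_comap, layerProj_basisVec]
  split_ifs
  · exact basisVec_mem_basisSpan j.isLt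
  · exact zero_mem _

variable [DecidableRel G.Adj]

lemma isTModule_of_mem (hA : ∀ w ∈ W, adjOp G w ∈ W)
    (hE : ∀ i, ∀ w ∈ W, layerProj G x i w ∈ W) : IsTModule G x W := by
  intro B hB
  induction hB using Algebra.adjoin_induction with
  | mem B hB =>
    obtain rfl | ⟨i, rfl⟩ := hB
    · exact hA
    · exact hE i
  | algebraMap r =>
    intro w hw
    simpa [Algebra.algebraMap_eq_smul_one] using W.smul_mem r hw
  | add B C _ _ hB hC =>
    intro w hw
    rw [map_add]
    exact W.add_mem (hB w hw) (hC w hw)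
  | mul B C _ _ hB hC =>
    intro w hw
    rw [toEuclideanLin_mul_apply]
    exact hB _ (hC w hw)

lemma IsTModule.subconst_le (hW : IsTModule G x W) (i : ℕ) : subconst G x i W ≤ W :=
  Submodule.map_le_iff_le_comap.2 fun w hw => hW _ (Algebra.subset_adjoin (.inr ⟨i, rfl⟩)) w hw

namespace IsBipartiteDRG

lemma layerVec_mem_subconst (h : IsBipartiteDRG G) (hD : 0 < G.diam) (hW : IsTModule G x W)
    (hv : v ∈ W) (i j : ℕ) : layerVec G x v i j ∈ subconst G x i W := by
  rw [layerVec, toEuclideanLin_mul_apply]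
  exact layerProj_mem_subconst (hW _ (h.distMatrix_mem_terwilligerAlgebra hD x j) v hv) i

lemma isEndpointTwo (h : IsBipartiteDRG G) (hD : 0 < G.diam) (hW : IsTModule G x W)
    (hend : endpoint G x W = 2) (hv : v ∈ subconst G x 2 W) : IsEndpointTwo G x v := by
  have hvanish {i : ℕ} (hi : i < 2) (j : ℕ) : layerVec G x v i j = 0 := by
    rw [← Submodule.mem_bot ℂ, ← subconst_eq_bot_of_lt_endpoint (hi.trans_eq hend.symm)]
    exact h.layerVec_mem_subconst hD hW (hW.subconst_le 2 hv) i j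
  have hlayer := layerProj_eq_of_mem_subconst hv
  refine ⟨hlayer, hvanish (by lia) 1, ?_⟩
  rw [← layerVec_zero_apply_self hlayer, hvanish (by lia) 2, PiLp.zero_apply]

lemma isThinEndpointTwo (h : IsBipartiteDRG G) (hD : 0 < G.diam) (hW : IsTModule G x W)
    (hthin : IsThin G x W) (hend : endpoint G x W = 2) (hloc : HasLocalEigenvalue G x W η)
    (hv : v ∈ subconst G x 2 W) (hv_ne : v ≠ 0) : IsThinEndpointTwo G x v η where
  toIsEndpointTwo := h.isEndpointTwo hD hW hend hv
  ne_zero := hv_ne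
  layerVec_two_two := by
    rw [← hloc v hv, toEuclideanLin_mul_apply _ (Estar G x 2), layerProj_eq_of_mem_subconst hv]
  exists_smul_eq j hj :=
    have hmem := h.layerVec_mem_subconst hD hW (hW.subconst_le 2 hv) (j + 2)
    exists_smul_eq_of_finrank_le_one (hthin (j + 2)) (hmem j) hj (hmem (j + 4))

end IsBipartiteDRG

namespace IsThinEndpointTwo

lemma adjOp_mem_basisSpan (hv : IsThinEndpointTwo G x v (tilde G θ)) (h : IsBipartiteDRG G)
    (hD : 0 < G.diam) {m : ℕ} (hrel : ∀ j < m, LayerRelations G x v θ j)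
    (hlast : basisVec G x v m = 0) {w : EuclideanSpace ℂ X} (hw : w ∈ basisSpan G x v m) :
    adjOp G w ∈ basisSpan G x v m := by
  have hmem {j : ℕ} (hj : j ≤ m) : basisVec G x v j ∈ basisSpan G x v m := by
    obtain hj | rfl := hj.lt_or_eq
    · exact basisVec_mem_basisSpan hj
    · exact hlast ▸ zero_mem _
  refine Submodule.span_le (p := (basisSpan G x v m).comap (adjOp G)).2 ?_ hw
  rintro _ ⟨⟨j, hj⟩, rfl⟩
  rw [SetLike.mem_coe, Submodule.mem_comap]
  cases j with
  | zero =>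
    rw [hv.adjOp_basisVec_zero h hD]
    exact hmem hj
  | succ j =>
    rw [hv.adjOp_basisVec_succ h hD (hrel j (by lia))]
    exact add_mem (Submodule.smul_mem _ _ (hmem (by lia))) (Submodule.smul_mem _ _ (hmem hj))

lemma isTModule_basisSpan (hv : IsThinEndpointTwo G x v (tilde G θ)) (h : IsBipartiteDRG G)
    (hD : 4 ≤ G.diam) (hp : ∀ i < G.diam - 1, (pPoly G i).eval θ ≠ 0)
    (hroot : (pPoly G (G.diam - 1)).eval θ = 0) :
    IsTModule G x (basisSpan G x v (G.diam - 3)) := by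
  have hrel {j : ℕ} (hj : j < G.diam - 3) := hv.layerRelations h hp (j := j) (by lia)
  have hlast : basisVec G x v (G.diam - 3) = 0 := by
    obtain ⟨m, hm⟩ := Nat.exists_eq_add_of_le' hD
    simp only [hm, Nat.reduceSubDiff] at hroot ⊢
    exact hv.basisVec_succ_eq_zero h (by lia) (hrel (by lia)) hroot
  exact isTModule_of_mem (fun w => hv.adjOp_mem_basisSpan h (by lia) (fun j => hrel) hlast)
    fun i w => layerProj_mem_basisSpan i

lemma basisSpan_eq (hv : IsThinEndpointTwo G x v (tilde G θ)) (h : IsBipartiteDRG G)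
    (hD : 4 ≤ G.diam) (hp : ∀ i < G.diam - 1, (pPoly G i).eval θ ≠ 0)
    (hroot : (pPoly G (G.diam - 1)).eval θ = 0) (hW : IsIrreducibleTModule G x W) (hvW : v ∈ W) :
    basisSpan G x v (G.diam - 3) = W := by
  obtain ⟨hT, -, hmin⟩ := hW
  have hle : basisSpan G x v (G.diam - 3) ≤ W := by
    refine Submodule.span_le.2 ?_
    rintro _ ⟨j, rfl⟩
    exact hT.subconst_le _ (h.layerVec_mem_subconst (by lia) hT hvW (j + 2) j)
  refine (hmin _ (hv.isTModule_basisSpan h hD hp hroot) hle).resolve_left fun hbot => hv.ne_zero ?_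
  have hmem : basisVec G x v 0 ∈ basisSpan G x v (G.diam - 3) := basisVec_mem_basisSpan (by lia)
  rwa [hbot, Submodule.mem_bot, hv.basisVec_zero h.connected] at hmem

end IsThinEndpointTwo

end TModules

end DRG

theorem mainTheorem8 {X : Type*} [Fintype X] [DecidableEq X]
    (G : SimpleGraph X) [DecidableRel G.Adj]
    (hdr : DRG.IsDistanceRegular G) (hbip : G.IsBipartite)
    (D : ℕ) (hdiam : G.diam = D) (hD : 4 ≤ D)
    (k : ℕ) (hreg : G.IsRegularOfDegree k) (hk : 3 ≤ k)
    (x : X) (n : ℕ) (hn : n = 1 ∨ (Odd D ∧ n = D / 2))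
    (W : Submodule ℂ (EuclideanSpace ℂ X))
    (hirr : DRG.IsIrreducibleTModule G x W) (hthin : DRG.IsThin G x W)
    (hend : DRG.endpoint G x W = 2)
    (hloc : DRG.HasLocalEigenvalue G x W (DRG.tilde G (DRG.theta G n)))
    (v : EuclideanSpace ℂ X) (hvW : v ∈ DRG.subconst G x 2 W) (hv : v ≠ 0) :
    -- the vectors `E*_{i+2} A_i v`, `0 ≤ i ≤ D - 4`, form a basis of `W`
    (LinearIndependent ℂ (fun i : Fin (D - 3) => DRG.basisVec G x v i) ∧
      Submodule.span ℂ (Set.range fun i : Fin (D - 3) => DRG.basisVec G x v i) = W) ∧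
    -- they are mutually orthogonal
    (∀ i j : ℕ, i ≤ D - 4 → j ≤ D - 4 → i ≠ j →
      inner ℂ (DRG.basisVec G x v i) (DRG.basisVec G x v j) = 0) ∧
    -- the denominators do not vanish, and the square norms are as claimed
    (k : ℝ) * DRG.b G 1 * (DRG.theta G n ^ 2 - DRG.b G 2) ≠ 0 ∧
    (∀ i : ℕ, i ≤ D - 4 →
      (DRG.pPoly G i).eval (DRG.theta G n) ≠ 0 ∧
      ‖DRG.basisVec G x v i‖ ^ 2 =
        ((DRG.kval G i : ℝ) * DRG.b G i * DRG.b G (i + 1) * DRG.c G (i + 1) * DRG.c G (i + 2)) /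
            ((k : ℝ) * DRG.b G 1 * (DRG.theta G n ^ 2 - DRG.b G 2)) *
          ((DRG.pPoly G (i + 2)).eval (DRG.theta G n) / (DRG.pPoly G i).eval (DRG.theta G n)) *
          ‖v‖ ^ 2) := by
  subst hdiam
  have h : DRG.IsBipartiteDRG G := ⟨hdr, hbip⟩
  obtain rfl : k = DRG.b G 0 := (hreg x).symm.trans (hdr.degree_eq x)
  have hp : ∀ i < G.diam - 1, (DRG.pPoly G i).eval (DRG.theta G n) ≠ 0 := by
    rcases hn with rfl | ⟨hodd, rfl⟩
    · exact fun i => h.eval_pPoly_theta_one_ne_zero (by lia)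
    · exact fun i => h.eval_pPoly_theta_half_ne_zero (by lia) hodd
  have hroot : (DRG.pPoly G (G.diam - 1)).eval (DRG.theta G n) = 0 :=
    h.eval_pPoly_theta (by lia) (by lia) (by lia)
  have hv_thin : DRG.IsThinEndpointTwo G x v (DRG.tilde G (DRG.theta G n)) :=
    h.isThinEndpointTwo (by lia) hirr.1 hthin hend hloc hvW hv
  exact ⟨⟨hv_thin.linearIndependent_basisVec h hp,
      hv_thin.basisSpan_eq h hD hp hroot hirr (hirr.1.subconst_le 2 hvW)⟩,
    fun _ _ _ _ => DRG.inner_basisVec_eq_zero,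
    h.denominator_ne_zero (by lia) (hp 2 (by lia)),
    fun i hi => ⟨hp i (by lia), hv_thin.norm_sq_basisVec h hp (by lia)⟩⟩
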